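/- Let $M,k>0$, $a\ge 0$ with $ak<1$, and suppose that $\Delta(r):=(r^2+a^2)(1+k^2r^2)-2Mr$ has two distinct non-negative roots; let $r_+$ be its largest root. Put $\Xi=1-a^2k^2$, $\Delta_\vartheta=1-a^2k^2\cos^2\vartheta$, $\Sigma=r^2+a^2\cos^2\vartheta$, $\omega_+=\frac{a}{r_+^2+a^2}$, and let $r^\star$ be the function on $(r_+,\infty)$ with $\frac{dr^\star}{dr}=\frac{r^2+a^2}{\Delta}$ and $r^\star\to0$ as $r\to\infty$. Assume the strict Hawking-Reall bound $a<kr_+^2$. Then there is $m_0=m_0(M,a,k)\in\mathbb N$ such that for every $m\in\mathbb Z$ with $|m|\ge m_0$ there is no pair $(\widetilde\alpha^{[+2]},\widetilde\alpha^{[-2]})$, not identically zero on $\mathbb R_t\times(r_+,\infty)_r\times\mathbb S^2_{\vartheta,\varphi}$, of the form $$\widetilde\alpha^{[+2]}=e^{-im\omega_+t}R^{[+2]}(r)S^{[+2]}(\vartheta)e^{im\varphi},\qquad \widetilde\alpha^{[-2]}=e^{im\omega_+t}R^{[-2]}(r)S^{[-2]}(\vartheta)e^{-im\varphi}$$ with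 complex-valued $R^{[\pm2]},S^{[\pm2]}$, which satisfies all of the following. 1. (Regularity up to infinity.) $\widetilde\alpha^{[\pm2]}$, as functions of $(t,r^\star)$, extend to $C^\infty(\mathbb R_t\times(-\infty,0]_{r^\star},\mathcal S^{[\pm2]})$, where $\mathcal S^{[s]}$ is the space of smooth spin-$s$-weighted complex functions on $\mathbb S^2$, i.e. functions $f(\vartheta,\varphi)$ such that $e^{is\varphi}f$ and $e^{-is\varphi}f$ extend to smooth functions on the sphere minus the south pole $\vartheta=\pi$ and minus the north pole $\vartheta=0$, respectively. 2. (Teukolsky equations.) $\alpha^{[+2]}:=\Delta^{-1}(r^2+a^2)^{-1/2}\widetilde\alpha^{[+2]}$ and $\alpha^{[-2]}:=\Delta(r^2+a^2)^{-1/2}\widetilde\alpha^{[-2]}$ satisfy $$\begin{aligned}0={}&\Box\alpha^{[\pm2]}\pm2\tfrac{\partial_r\Delta}{\Sigma}\partial_r\alpha^{[\pm2]}\pm2\Xi\tfrac{\partial_r\Delta}{\Sigma\Delta}\big(a\partial_\varphi+(r^2+a^2)\partial_t\big)\alpha^{[\pm2]}\mp8\tfrac{\Xi r}{\Sigma}\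partial_t\alpha^{[\pm2]}+\tfrac{6k^2r^2+(1\pm1)\partial_r^2\Delta}{\Sigma}\alpha^{[\pm2]}\\&\pm4i\tfrac{\Xi\cot\vartheta}{\Sigma\Delta_\vartheta}\big(1-a^2k^2\cos(2\vartheta)\big)\big(a\sin\vartheta\,\partial_t+\tfrac{\partial_\varphi}{\sin\vartheta}\big)\alpha^{[\pm2]}\mp8i\tfrac{\Xi}{\Sigma}a\cos\vartheta\,\partial_t\alpha^{[\pm2]}-\tfrac1\Sigma\Big(2\Delta_\vartheta+2a^2k^2+4\tfrac{\Xi^2\cot^2\vartheta}{\Delta_\vartheta}\Big)\alpha^{[\pm2]}\end{aligned}$$ where $$\Box\alpha=\tfrac1\Sigma\partial_r(\Delta\partial_r\alpha)-\tfrac{\Xi^2}{\Sigma\Delta}\big(a\partial_\varphi+(r^2+a^2)\partial_t\big)^2\alpha+\tfrac1{\Sigma\sin\vartheta}\partial_\vartheta(\Delta_\vartheta\sin\vartheta\,\partial_\vartheta\alpha)+\tfrac{\Xi^2}{\Sigma\Delta_\vartheta}\big(a\sin\vartheta\,\partial_t+\tfrac{\partial_\varphi}{\sin\vartheta}\big)^2\alpha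 .$$ 3. (Regularity at the future event horizon.) With $L=\Xi\partial_t+\frac{a\Xi}{r^2+a^2}\partial_\varphi+\partial_{r^\star}$, $\underline L=\Xi\partial_t+\frac{a\Xi}{r^2+a^2}\partial_\varphi-\partial_{r^\star}$, $t^\star=t+r^\star-\frac1k\arctan(kr)$: for all $p,q\in\mathbb N$ and $t^\star_0\in\mathbb R$, $$L^p(\Delta^{-1}\underline L)^q\big(\Delta^{\pm1}\widetilde\alpha^{[\pm2]}\big)\big|_{t^\star=t^\star_0}=O(1)\quad\text{as } r\to r_+,\text{ uniformly on the spheres.}$$ 4. (Conformal boundary conditions.) At $r^\star=0$: $\ \widetilde\alpha^{[+2]}-\overline{\widetilde\alpha^{[-2]}}=0$ and $\partial_{r^\star}\widetilde\alpha^{[+2]}+\partial_{r^\star}\overline{\widetilde\alpha^{[-2]}}=0$. -/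

import Mathlib

open Set Filter Topology
open scoped ContDiff

noncomputable section

namespace KerrAdS

/-! ### Background geometry -/

/-- `Δ(r) = (r² + a²)(1 + k²r²) - 2Mr`. -/
def Delta (M a k r : ℝ) : ℝ := (r ^ 2 + a ^ 2) * (1 + k ^ 2 * r ^ 2) - 2 * M * r

/-- `Ξ = 1 - a²k²`. -/
def Xi (a k : ℝ) : ℝ := 1 - a ^ 2 * k ^ 2

/-- `Δ_ϑ = 1 - a²k² cos²ϑ`. -/
def DeltaTheta (a k θ : ℝ) : ℝ := 1 - a ^ 2 * k ^ 2 * Real.cos θ ^ 2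

/-- `Σ = r² + a² cos²ϑ`. -/
def Sigma (a r θ : ℝ) : ℝ := r ^ 2 + a ^ 2 * Real.cos θ ^ 2

/-- Admissible (subextremal) parameters: `M, k > 0`, `a ≥ 0`, `ak < 1`, and `Δ` has two distinct
non-negative roots. -/
def Admissible (M a k : ℝ) : Prop :=
  0 < M ∧ 0 < k ∧ 0 ≤ a ∧ a * k < 1 ∧
    ∃ r₁ r₂ : ℝ, 0 ≤ r₁ ∧ r₁ < r₂ ∧ Delta M a k r₁ = 0 ∧ Delta M a k r₂ = 0

/-- The horizon radius `r₊`, the largest root of `Δ`. For admissible parameters the set of roots is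
finite and non-empty, so that the supremum is a maximum. -/
def rPlus (M a k : ℝ) : ℝ := sSup {r : ℝ | Delta M a k r = 0}

/-- `ω₊ = a / (r₊² + a²)`. -/
def omegaPlus (M a k : ℝ) : ℝ := a / (rPlus M a k ^ 2 + a ^ 2)

/-- The tortoise coordinate on `(r₊, ∞)`: `dr⋆/dr = (r² + a²)/Δ` and `r⋆ → 0` as `r → ∞`. -/
def rStar (M a k r : ℝ) : ℝ := -∫ x in Ioi r, (x ^ 2 + a ^ 2) / Delta M a k x

/-- The strict Hawking-Reall bound `a < k r₊²`. -/
def HawkingReall (M a k : ℝ) : Prop := a < k * rPlus M a k ^ 2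

/-! ### Fields and first order operators

A spin-weighted function is represented by its complex component in the coordinates
`(t, r, ϑ, φ)`. Only the values on `r > r₊`, `0 < ϑ < π` are meaningful. -/

/-- Complex functions of `(t, r, ϑ, φ)`. -/
abbrev Field := ℝ → ℝ → ℝ → ℝ → ℂ

/-- The exterior region `r > r₊` in coordinates, away from the axis. -/
def Exterior (M a k r θ : ℝ) : Prop := rPlus M a k < r ∧ 0 < θ ∧ θ < Real.pi

/-- `∂_t` -/
def dT (f : Field) : Field := fun t r θ φ => deriv (fun t' => f t' r θ φ) t

/-- `∂_r` -/
def dR (f : Field) : Field := fun t r θ φ => deriv (fun r' => f t r' θ φ) r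

/-- `∂_ϑ` -/
def dTheta (f : Field) : Field := fun t r θ φ => deriv (fun θ' => f t r θ' φ) θ

/-- `∂_φ` -/
def dPhi (f : Field) : Field := fun t r θ φ => deriv (fun φ' => f t r θ φ') φ

/-- `∂_{r⋆} = Δ/(r² + a²) ∂_r` -/
def dRStar (M a k : ℝ) (f : Field) : Field := fun t r θ φ =>
  ((Delta M a k r / (r ^ 2 + a ^ 2) : ℝ) : ℂ) * dR f t r θ φ

/-- `a ∂_φ + (r² + a²) ∂_t` -/
def opA (a : ℝ) (f : Field) : Field := fun t r θ φ =>
  (a : ℂ) * dPhi f t r θ φ + ((r ^ 2 + a ^ 2 : ℝ) : ℂ) * dT f t r θ φ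

/-- `a sin ϑ ∂_t + (1/sin ϑ) ∂_φ` -/
def opB (a : ℝ) (f : Field) : Field := fun t r θ φ =>
  ((a * Real.sin θ : ℝ) : ℂ) * dT f t r θ φ + ((1 / Real.sin θ : ℝ) : ℂ) * dPhi f t r θ φ

/-- `L = Ξ ∂_t + (aΞ/(r² + a²)) ∂_φ + ∂_{r⋆}` -/
def opL (M a k : ℝ) (f : Field) : Field := fun t r θ φ =>
  (Xi a k : ℂ) * dT f t r θ φ + ((a * Xi a k / (r ^ 2 + a ^ 2) : ℝ) : ℂ) * dPhi f t r θ φ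
    + dRStar M a k f t r θ φ

/-- `L̲ = Ξ ∂_t + (aΞ/(r² + a²)) ∂_φ - ∂_{r⋆}` -/
def opLbar (M a k : ℝ) (f : Field) : Field := fun t r θ φ =>
  (Xi a k : ℂ) * dT f t r θ φ + ((a * Xi a k / (r ^ 2 + a ^ 2) : ℝ) : ℂ) * dPhi f t r θ φ
    - dRStar M a k f t r θ φ

/-- `Δ⁻¹ L̲` -/
def opDeltaInvLbar (M a k : ℝ) (f : Field) : Field := fun t r θ φ =>
  (((Delta M a k r)⁻¹ : ℝ) : ℂ) * opLbar M a k f t r θ φ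

/-! ### The Teukolsky equations -/

/-- The wave operator (in coordinates) of the Kerr-adS metric. -/
def box (M a k : ℝ) (f : Field) : Field := fun t r θ φ =>
  ((1 / Sigma a r θ : ℝ) : ℂ)
      * dR (fun t r θ φ => (Delta M a k r : ℂ) * dR f t r θ φ) t r θ φ
    - ((Xi a k ^ 2 / (Sigma a r θ * Delta M a k r) : ℝ) : ℂ) * opA a (opA a f) t r θ φ
    + ((1 / (Sigma a r θ * Real.sin θ) : ℝ) : ℂ)
      * dTheta (fun t r θ φ =>
          ((DeltaTheta a k θ * Real.sin θ : ℝ) : ℂ) * dTheta f t r θ φ) t r θ φ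
    + ((Xi a k ^ 2 / (Sigma a r θ * DeltaTheta a k θ) : ℝ) : ℂ) * opB a (opB a f) t r θ φ

/-- The Teukolsky operator acting on `α^{[2σ]}`, for `σ = 1` and `σ = -1`. -/
def teukolsky (M a k : ℝ) (σ : ℤ) (f : Field) : Field := fun t r θ φ =>
  box M a k f t r θ φ
    + σ * ((2 * (deriv (Delta M a k) r / Sigma a r θ) : ℝ) : ℂ) * dR f t r θ φ
    + σ * ((2 * Xi a k * (deriv (Delta M a k) r / (Sigma a r θ * Delta M a k r)) : ℝ) : ℂ)
        * opA a f t r θ φ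
    - σ * ((8 * (Xi a k * r / Sigma a r θ) : ℝ) : ℂ) * dT f t r θ φ
    + (((6 * k ^ 2 * r ^ 2 + (1 + σ) * deriv (deriv (Delta M a k)) r) / Sigma a r θ : ℝ) : ℂ)
        * f t r θ φ
    + σ * (4 * Complex.I)
        * ((Xi a k * Real.cot θ / (Sigma a r θ * DeltaTheta a k θ)
            * (1 - a ^ 2 * k ^ 2 * Real.cos (2 * θ)) : ℝ) : ℂ) * opB a f t r θ φ
    - σ * (8 * Complex.I) * ((Xi a k / Sigma a r θ * a * Real.cos θ : ℝ) : ℂ) * dT f t r θ φ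
    - ((1 / Sigma a r θ * (2 * DeltaTheta a k θ + 2 * a ^ 2 * k ^ 2
          + 4 * (Xi a k ^ 2 * Real.cot θ ^ 2 / DeltaTheta a k θ)) : ℝ) : ℂ) * f t r θ φ

/-- The field `α^{[2σ]}` with renormalisation `α̃^{[2σ]} = Δ^σ (r² + a²)^{1/2} α^{[2σ]}`. -/
def unrenormalise (M a k : ℝ) (σ : ℤ) (f : Field) : Field := fun t r θ φ =>
  ((Delta M a k r ^ (-σ) * (Real.sqrt (r ^ 2 + a ^ 2))⁻¹ : ℝ) : ℂ) * f t r θ φ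

/-- The Teukolsky equation for the renormalised field `α̃^{[2σ]}`, on the exterior region. -/
def SolvesTeukolsky (M a k : ℝ) (σ : ℤ) (f : Field) : Prop :=
  ∀ t r θ φ : ℝ, Exterior M a k r θ → teukolsky M a k σ (unrenormalise M a k σ f) t r θ φ = 0

/-! ### Regularity and boundary conditions -/

/-- `β(t, x, ϑ, φ)` is a smooth function of `(t, x) ∈ ℝ × (-∞, 0]` with values in the smooth spin-`s`
weighted functions on the sphere. Smoothness across the poles is expressed in the two stereographic
charts `ζ = tan(ϑ/2) e^{iφ}` (sphere minus south pole) and `η = cot(ϑ/2) e^{iφ}` (sphere minus north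
pole): there `e^{isφ} β`, respectively `e^{-isφ} β`, is a smooth function. -/
def SmoothSpinWeighted (s : ℤ) (β : Field) : Prop :=
  ∃ N S : ℝ × ℝ × ℂ → ℂ,
    ContDiffOn ℝ ∞ N (univ ×ˢ Iic 0 ×ˢ univ) ∧
    ContDiffOn ℝ ∞ S (univ ×ˢ Iic 0 ×ˢ univ) ∧
    ∀ t x θ φ : ℝ, x ≤ 0 → 0 < θ → θ < Real.pi →
      Complex.exp (Complex.I * s * φ) * β t x θ φ
          = N (t, x, (Real.tan (θ / 2) : ℂ) * Complex.exp (Complex.I * φ)) ∧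
      Complex.exp (-(Complex.I * s * φ)) * β t x θ φ
          = S (t, x, (Real.cot (θ / 2) : ℂ) * Complex.exp (Complex.I * φ))

/-- Regularity up to infinity of a spin-`s` weighted field: as a function of `(t, r⋆)` it extends
smoothly to `ℝ × (-∞, 0]`, with values in the smooth spin-`s` weighted functions. -/
def RegularUpToInfinity (M a k : ℝ) (s : ℤ) (f : Field) : Prop :=
  ∃ β : Field, SmoothSpinWeighted s β ∧
    ∀ t r θ φ : ℝ, Exterior M a k r θ → f t r θ φ = β t (rStar M a k r) θ φ

/-- The value of `t` at radius `r` on the level set `t⋆ = t₀` of the function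
`t⋆ = t + r⋆ - (1/k) arctan(kr)`. -/
def tOnSlice (M a k t₀ r : ℝ) : ℝ := t₀ - rStar M a k r + 1 / k * Real.arctan (k * r)

/-- Regularity of `α̃^{[2σ]}` at the future event horizon: for all `p, q` and `t₀`, the restriction of
`L^p (Δ⁻¹L̲)^q (Δ^σ α̃)` to `t⋆ = t₀` is `O(1)` as `r → r₊` (uniformly on the spheres). -/
def RegularAtHorizon (M a k : ℝ) (σ : ℤ) (f : Field) : Prop :=
  ∀ (p q : ℕ) (t₀ : ℝ), ∃ C δ : ℝ, 0 < δ ∧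
    ∀ r θ φ : ℝ, Exterior M a k r θ → r < rPlus M a k + δ →
      ‖((opL M a k)^[p] ((opDeltaInvLbar M a k)^[q]
          (fun t r θ φ => ((Delta M a k r ^ σ : ℝ) : ℂ) * f t r θ φ)))
            (tOnSlice M a k t₀ r) r θ φ‖ ≤ C

/-- The conformal boundary conditions `α̃⁺ - conj α̃⁻ = 0` and
`∂_{r⋆} α̃⁺ + ∂_{r⋆} conj α̃⁻ = 0` at `r⋆ = 0`; boundary values at `r⋆ = 0` are limits `r → ∞`. -/
def ConformalBC (M a k : ℝ) (fp fm : Field) : Prop :=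
  ∀ t θ φ : ℝ, 0 < θ → θ < Real.pi →
    Tendsto (fun r => fp t r θ φ - (starRingEnd ℂ) (fm t r θ φ)) atTop (𝓝 0) ∧
    Tendsto (fun r => dRStar M a k fp t r θ φ
      + dRStar M a k (fun t r θ φ => (starRingEnd ℂ) (fm t r θ φ)) t r θ φ) atTop (𝓝 0)

/-! ### Stationary modes -/

/-- `(α̃⁺, α̃⁻)` has the form `α̃⁺ = e^{-imω₊t} R⁺(r) S⁺(ϑ) e^{imφ}`,
`α̃⁻ = e^{imω₊t} R⁻(r) S⁻(ϑ) e^{-imφ}`. -/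
def IsStationaryMode (M a k : ℝ) (m : ℤ) (fp fm : Field) : Prop :=
  ∃ Rp Rm Sp Sm : ℝ → ℂ, ∀ t r θ φ : ℝ, Exterior M a k r θ →
    fp t r θ φ = Complex.exp (-(Complex.I * m * omegaPlus M a k * t)) * Rp r * Sp θ
        * Complex.exp (Complex.I * m * φ) ∧
    fm t r θ φ = Complex.exp (Complex.I * m * omegaPlus M a k * t) * Rm r * Sm θ
        * Complex.exp (-(Complex.I * m * φ))

/-- The pair `(α̃⁺, α̃⁻)` does not vanish identically on the exterior region. -/
def Nontrivial (M a k : ℝ) (fp fm : Field) : Prop :=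
  ∃ t r θ φ : ℝ, Exterior M a k r θ ∧ (fp t r θ φ ≠ 0 ∨ fm t r θ φ ≠ 0)

end KerrAdS

end

/-!
# Stationary modes of large azimuthal number on Kerr-anti-de Sitter

On a mode that corotates with the horizon the Teukolsky equations separate. With the normalisation
of `α̃^{[±2]}` both radial profiles satisfy the same equation without first order term,
`(r² + a²) ∂_r ∂_{r⋆} A = W A`, where
`Re W = Re λ - Ξ² m² κ² / Δ + U`, `κ = ω₊ (r² - r₊²)`, `λ` is the separation constant, and `U` does
not depend on the mode and is bounded below (`exists_separation`, `hasDerivAt_tortoiseDeriv`,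
`exists_staticPot_ge`).

Two estimates make `Re W` positive for large `|m|`. The angular equation gives
`Re λ ≥ c m² - O(|m|)` with `c = Ξ² r₊⁴ / (r₊² + a²)²` (`exists_angPot_ge`, `le_re_of_angularOp`),
and the rotational term is at most `Ξ² ω₊² m² / k²` (`corot_term_le`). The Hawking-Reall bound says
exactly that the second constant is smaller than the first (`HawkingReall.lt_angFloor`).

Given `Re W > 0`, the flux `Re (∂_{r⋆} A Ā)` increases with `r`. The conformal boundary conditions
are such that the sum of the fluxes of `α̃^{[+2]}` and `α̃^{[-2]}` vanishes at infinity. At the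
horizon the characteristic exponents are `Δ` and `Δ⁻¹`. For spin `-2` regularity excludes the second
at once (`tendsto_flux_of_spin_neg`). For spin `+2` the solution with exponent `Δ⁻¹` generally
carries a logarithm, ruled out by boundedness of the first three powers of `Δ⁻¹ L̲`; it is free of
the logarithm only if `λ` solves a quadratic equation whose roots are of size `O(|m|)`, impossible
when `Re λ` grows like `m²` (`exists_resonance_ne_zero`, `tendsto_flux_of_spin_pos`).
Hence the total flux is increasing and vanishes at both ends, so that both profiles vanish (`IsRadialProfile.eq_zero`).

The arguments with fluxes use only monotonicity and limits at the end points, not integrals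
(`deriv_eq_zero_of_tendsto_zero`); the same device gives the bound on the angular eigenvalue.
-/

namespace KerrAdS

/-! ### The horizon function -/

theorem continuous_Delta (M a k : ℝ) : Continuous (Delta M a k) := by
  unfold Delta; fun_prop

/-- The cofactor in `Δ(r) = (r - r₊) · slope(r)`. -/
noncomputable def slope (M a k r : ℝ) : ℝ :=
  k ^ 2 * r * (r ^ 2 + r * rPlus M a k + rPlus M a k ^ 2) + (1 + a ^ 2 * k ^ 2) * r
    - a ^ 2 / rPlus M a k

/-- `Δ` is a convex quartic; its largest root is attained, and exceeds the smaller root. -/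
theorem Admissible.exists_root_lt {M a k : ℝ} (h : Admissible M a k) :
    ∃ r₁, 0 ≤ r₁ ∧ r₁ < rPlus M a k ∧ Delta M a k r₁ = 0 ∧ Delta M a k (rPlus M a k) = 0 := by
  obtain ⟨hM, hk, -, -, r₁, r₂, h0, h12, e1, e2⟩ := h
  have hbdd : BddAbove {r : ℝ | Delta M a k r = 0} := by
    refine ⟨2 * M / k ^ 2 + 1, fun r hr => ?_⟩
    by_contra! hlt
    have hr' : Delta M a k r = 0 := hr
    have hq : 0 < 2 * M / k ^ 2 := by positivity
    have h1 : 1 < r := by linarith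
    have h2 : 2 * M < r * k ^ 2 := by
      rw [← div_lt_iff₀ (by positivity)]; linarith
    have h3 : 0 < r ^ 2 * (r * (r * k ^ 2) - 2 * M) := by
      have : 2 * M < r * (r * k ^ 2) := by nlinarith
      have h1' : 0 < r ^ 2 := by positivity
      exact mul_pos h1' (by linarith)
    have h4 : 0 < r ^ 2 + a ^ 2 + a ^ 2 * k ^ 2 * r ^ 2 := by positivity
    have h5 : 2 * M * r ≤ 2 * M * r ^ 2 := by
      have : r ≤ r ^ 2 := by nlinarith
      exact mul_le_mul_of_nonneg_left this (by linarith)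
    unfold Delta at hr'
    nlinarith
  have hne : {r : ℝ | Delta M a k r = 0}.Nonempty := ⟨r₂, e2⟩
  have hcl : IsClosed {r : ℝ | Delta M a k r = 0} :=
    isClosed_eq (continuous_Delta M a k) continuous_const
  exact ⟨r₁, h0, h12.trans_le (le_csSup hbdd e2), e1, hcl.csSup_mem hne hbdd⟩

theorem Admissible.rPlus_pos {M a k : ℝ} (h : Admissible M a k) : 0 < rPlus M a k := by
  obtain ⟨r, h0, h1, -⟩ := h.exists_root_lt
  linarith

theorem Admissible.Delta_eq {M a k : ℝ} (h : Admissible M a k) (r : ℝ) :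
    Delta M a k r = (r - rPlus M a k) * slope M a k r := by
  have hp := h.rPlus_pos
  obtain ⟨-, -, -, -, hr⟩ := h.exists_root_lt
  unfold slope
  have h2 : 2 * M = (rPlus M a k ^ 2 + a ^ 2) * (1 + k ^ 2 * rPlus M a k ^ 2) / rPlus M a k := by
    rw [eq_div_iff hp.ne']
    unfold Delta at hr
    linarith
  unfold Delta
  rw [h2]
  generalize rPlus M a k = p at *
  field_simp
  ring

theorem Admissible.slope_strictMono {M a k : ℝ} (h : Admissible M a k) :
    StrictMonoOn (slope M a k) (Ici 0) := by
  intro x (hx : 0 ≤ x) y (hy : 0 ≤ y) hxy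
  have hp := h.rPlus_pos
  unfold slope
  have h1 : k ^ 2 * x * (x ^ 2 + x * rPlus M a k + rPlus M a k ^ 2) ≤
      k ^ 2 * y * (y ^ 2 + y * rPlus M a k + rPlus M a k ^ 2) := by gcongr
  have h2 : (1 + a ^ 2 * k ^ 2) * x < (1 + a ^ 2 * k ^ 2) * y := by gcongr
  linarith

theorem Admissible.slope_rPlus_pos {M a k : ℝ} (h : Admissible M a k) :
    0 < slope M a k (rPlus M a k) := by
  obtain ⟨r, h0, h1, e1, -⟩ := h.exists_root_lt
  have := h.slope_strictMono (show r ∈ Ici 0 from h0) h.rPlus_pos.le h1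
  rw [h.Delta_eq] at e1
  rcases mul_eq_zero.1 e1 with e | e <;> linarith

theorem Admissible.slope_rPlus_le {M a k r : ℝ} (h : Admissible M a k) (hr : rPlus M a k ≤ r) :
    slope M a k (rPlus M a k) ≤ slope M a k r :=
  h.slope_strictMono.monotoneOn h.rPlus_pos.le (h.rPlus_pos.le.trans hr) hr

theorem Admissible.slope_pos {M a k r : ℝ} (h : Admissible M a k) (hr : rPlus M a k ≤ r) :
    0 < slope M a k r :=
  h.slope_rPlus_pos.trans_le (h.slope_rPlus_le hr)

theorem Admissible.Delta_pos {M a k r : ℝ} (h : Admissible M a k) (hr : rPlus M a k < r) :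
    0 < Delta M a k r := by
  rw [h.Delta_eq]
  exact mul_pos (by linarith) (h.slope_pos hr.le)

theorem HawkingReall.sq_lt {M a k : ℝ} (h : Admissible M a k) (hHR : HawkingReall M a k) :
    a ^ 2 < k ^ 2 * rPlus M a k ^ 4 := by
  have h0 : 0 ≤ a := h.2.2.1
  unfold HawkingReall at hHR
  calc a ^ 2 < (k * rPlus M a k ^ 2) ^ 2 := by gcongr
    _ = _ := by ring

/-- The bound `a² < k² r₊⁴` absorbs the only negative term of the cofactor. -/
theorem cube_le_slope {M a k r : ℝ} (h : Admissible M a k) (hHR : HawkingReall M a k)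
    (hr : rPlus M a k ≤ r) : k ^ 2 * r ^ 3 ≤ slope M a k r := by
  have hp := h.rPlus_pos
  have hr0 : 0 < r := hp.trans_le hr
  have h1 := hHR.sq_lt h
  have h2 : a ^ 2 / rPlus M a k ≤ k ^ 2 * rPlus M a k ^ 3 := by
    rw [div_le_iff₀ hp]; linarith
  have h3 : k ^ 2 * rPlus M a k ^ 3 ≤ k ^ 2 * r * (r * rPlus M a k) := by
    calc k ^ 2 * rPlus M a k ^ 3 = k ^ 2 * rPlus M a k * (rPlus M a k * rPlus M a k) := by ring
      _ ≤ _ := by gcongr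
  have h4 : 0 ≤ k ^ 2 * r * rPlus M a k ^ 2 := by positivity
  have h5 : 0 ≤ (1 + a ^ 2 * k ^ 2) * r := by positivity
  unfold slope
  nlinarith

/-! ### The tortoise coordinate -/

theorem contDiff_Delta (M a k : ℝ) : ContDiff ℝ ∞ (Delta M a k) := by
  unfold Delta; fun_prop

theorem continuousOn_tortoise {M a k : ℝ} (h : Admissible M a k) :
    ContinuousOn (fun x => (x ^ 2 + a ^ 2) / Delta M a k x) (Ioi (rPlus M a k)) :=
  ContinuousOn.div (by fun_prop) (continuous_Delta M a k).continuousOn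
    fun _ hx => (h.Delta_pos hx).ne'

theorem integrableOn_tortoise {M a k r : ℝ} (h : Admissible M a k) (hHR : HawkingReall M a k)
    (hr : rPlus M a k < r) :
    MeasureTheory.IntegrableOn (fun x => (x ^ 2 + a ^ 2) / Delta M a k x) (Ioi r) := by
  have hp := h.rPlus_pos
  have hk : 0 < k := h.2.1
  have hr0 : 0 < r := hp.trans hr
  have hsub : Ioi r ⊆ Ioi (rPlus M a k) := Ioi_subset_Ioi hr.le
  set C : ℝ := (1 + a ^ 2 / rPlus M a k ^ 2) / (k ^ 2 * (1 - rPlus M a k / r)) with hC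
  have hq : 0 < 1 - rPlus M a k / r := by rw [sub_pos, div_lt_one hr0]; exact hr
  refine MeasureTheory.Integrable.mono'
    ((integrableOn_Ioi_rpow_of_lt (by norm_num : (-2 : ℝ) < -1) hr0).const_mul C)
    ((continuousOn_tortoise h).mono hsub |>.aestronglyMeasurable measurableSet_Ioi) ?_
  refine (MeasureTheory.ae_restrict_iff' measurableSet_Ioi).2 (Eventually.of_forall ?_)
  intro x (hx : r < x)
  have hx0 : 0 < x := hr0.trans hx
  have hD := h.Delta_pos (hr.trans hx)
  rw [Real.norm_of_nonneg (by positivity)]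
  have h1 : k ^ 2 * (1 - rPlus M a k / r) * x ^ 4 ≤ Delta M a k x := by
    rw [h.Delta_eq]
    have e1 : (1 - rPlus M a k / r) * x ≤ x - rPlus M a k := by
      have : rPlus M a k ≤ rPlus M a k / r * x := by
        rw [div_mul_eq_mul_div, le_div_iff₀ hr0]; gcongr
      linarith
    calc k ^ 2 * (1 - rPlus M a k / r) * x ^ 4
        = ((1 - rPlus M a k / r) * x) * (k ^ 2 * x ^ 3) := by ring
      _ ≤ (x - rPlus M a k) * slope M a k x := by
        gcongr
        · linarith
        · exact cube_le_slope h hHR (by linarith)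
  have h2 : x ^ 2 + a ^ 2 ≤ (1 + a ^ 2 / rPlus M a k ^ 2) * x ^ 2 := by
    have : a ^ 2 ≤ a ^ 2 / rPlus M a k ^ 2 * x ^ 2 := by
      rw [div_mul_eq_mul_div, le_div_iff₀ (by positivity)]
      have : rPlus M a k ≤ x := by linarith
      gcongr
    linarith
  have h3 : x ^ (-2 : ℝ) = (x ^ 2)⁻¹ := by
    rw [Real.rpow_neg hx0.le]; norm_num
  rw [h3, hC]
  calc (x ^ 2 + a ^ 2) / Delta M a k x
      ≤ ((1 + a ^ 2 / rPlus M a k ^ 2) * x ^ 2) / (k ^ 2 * (1 - rPlus M a k / r) * x ^ 4) := by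
        gcongr
    _ = _ := by field_simp

theorem hasDerivAt_rStar {M a k r : ℝ} (h : Admissible M a k) (hHR : HawkingReall M a k)
    (hr : rPlus M a k < r) :
    HasDerivAt (rStar M a k) ((r ^ 2 + a ^ 2) / Delta M a k r) r := by
  obtain ⟨b, hb1, hb2⟩ := exists_between hr
  have hint := integrableOn_tortoise h hHR hb1
  have hmeas := (continuousOn_tortoise h).stronglyMeasurableAtFilter (μ := MeasureTheory.volume)
    isOpen_Ioi r hr
  have hcont : ContinuousAt (fun x => (x ^ 2 + a ^ 2) / Delta M a k x) r :=
    (continuousOn_tortoise h).continuousAt (Ioi_mem_nhds hr)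
  have hII : IntervalIntegrable (fun x => (x ^ 2 + a ^ 2) / Delta M a k x)
      MeasureTheory.volume b r := by
    rw [intervalIntegrable_iff_integrableOn_Ioc_of_le hb2.le]
    exact hint.mono_set Ioc_subset_Ioi_self
  have hd := (intervalIntegral.integral_hasDerivAt_right hII hmeas hcont).sub_const
    (∫ x in Ioi b, (x ^ 2 + a ^ 2) / Delta M a k x)
  refine hd.congr_of_eventuallyEq ?_
  filter_upwards [Ioi_mem_nhds hb2] with x hx
  rw [← intervalIntegral.integral_Ioi_sub_Ioi hint (le_of_lt hx), rStar]
  ring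

theorem rStar_nonpos {M a k r : ℝ} (h : Admissible M a k) (hr : rPlus M a k < r) :
    rStar M a k r ≤ 0 := by
  unfold rStar
  rw [neg_nonpos]
  refine MeasureTheory.setIntegral_nonneg measurableSet_Ioi fun x hx => ?_
  have := h.Delta_pos (hr.trans hx)
  positivity

theorem tendsto_rStar_atTop {M a k : ℝ} (h : Admissible M a k) (hHR : HawkingReall M a k) :
    Tendsto (rStar M a k) atTop (𝓝 0) := by
  have hb : rPlus M a k < rPlus M a k + 1 := by linarith
  have hint := integrableOn_tortoise h hHR hb
  have h1 := MeasureTheory.intervalIntegral_tendsto_integral_Ioi _ hint tendsto_id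
  have h2 := h1.sub_const (∫ x in Ioi (rPlus M a k + 1), (x ^ 2 + a ^ 2) / Delta M a k x)
  rw [sub_self] at h2
  refine h2.congr' ?_
  filter_upwards [Ioi_mem_atTop (rPlus M a k + 1)] with x hx
  rw [id, ← intervalIntegral.integral_Ioi_sub_Ioi hint (le_of_lt hx), rStar]
  ring

theorem contDiffOn_rStar {M a k : ℝ} (h : Admissible M a k) (hHR : HawkingReall M a k) :
    ContDiffOn ℝ ∞ (rStar M a k) (Ioi (rPlus M a k)) := by
  rw [contDiffOn_infty_iff_deriv_of_isOpen isOpen_Ioi]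
  refine ⟨fun x hx => (hasDerivAt_rStar h hHR hx).differentiableAt.differentiableWithinAt, ?_⟩
  refine ContDiffOn.congr (f := fun x => (x ^ 2 + a ^ 2) / Delta M a k x) ?_
    fun x hx => (hasDerivAt_rStar h hHR hx).deriv
  exact ContDiffOn.div (by fun_prop) (contDiff_Delta M a k).contDiffOn
    fun _ hx => (h.Delta_pos hx).ne'

/-! ### Separation of variables -/

/-- The separated field `e^{-inω₊t} R(r) S(ϑ) e^{inφ}`, corotating with the horizon. -/
noncomputable def modeField (M a k : ℝ) (n : ℤ) (R S : ℝ → ℂ) : Field := fun t r θ φ =>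
  Complex.exp (-(Complex.I * n * omegaPlus M a k * t)) * R r * S θ
    * Complex.exp (Complex.I * n * φ)

/-- `κ(r) = ω₊ (r² - r₊²)`: on a separated field `a ∂_φ + (r² + a²) ∂_t` acts as `-inκ`. -/
noncomputable def corot (M a k r : ℝ) : ℝ := omegaPlus M a k * (r ^ 2 - rPlus M a k ^ 2)

/-- `Y(ϑ) = 1/sin ϑ - aω₊ sin ϑ`: on a separated field `a sin ϑ ∂_t + (1/sin ϑ) ∂_φ` acts
as `inY`. -/
noncomputable def angFreq (M a k θ : ℝ) : ℝ :=
  1 / Real.sin θ - a * omegaPlus M a k * Real.sin θ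

theorem dT_modeField (M a k : ℝ) (n : ℤ) (R S : ℝ → ℂ) :
    dT (modeField M a k n R S)
      = modeField M a k n (fun r => -(Complex.I * n * omegaPlus M a k) * R r) S := by
  funext t r θ φ
  have h : HasDerivAt (fun t' : ℝ => Complex.exp (-(Complex.I * n * omegaPlus M a k * t')))
      (Complex.exp (-(Complex.I * n * omegaPlus M a k * t))
        * -(Complex.I * n * omegaPlus M a k)) t := by
    have h1 := ((Complex.ofRealCLM.hasDerivAt (x := t)).const_mul
      (Complex.I * n * omegaPlus M a k)).neg.cexp
    simpa using h1
  unfold dT modeField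
  rw [deriv_mul_const_field, deriv_mul_const_field, deriv_mul_const_field, h.deriv]
  ring

theorem dPhi_modeField (M a k : ℝ) (n : ℤ) (R S : ℝ → ℂ) :
    dPhi (modeField M a k n R S) = modeField M a k n (fun r => Complex.I * n * R r) S := by
  funext t r θ φ
  have h : HasDerivAt (fun t' : ℝ => Complex.exp (Complex.I * n * t'))
      (Complex.exp (Complex.I * n * φ) * (Complex.I * n)) φ := by
    have h1 := ((Complex.ofRealCLM.hasDerivAt (x := φ)).const_mul (Complex.I * n)).cexp
    simpa using h1
  unfold dPhi modeField
  rw [deriv_const_mul_field, h.deriv]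
  ring

theorem dR_modeField (M a k : ℝ) (n : ℤ) (R S : ℝ → ℂ) :
    dR (modeField M a k n R S) = modeField M a k n (deriv R) S := by
  funext t r θ φ
  unfold dR modeField
  rw [deriv_mul_const_field, deriv_mul_const_field, deriv_const_mul_field]

theorem dTheta_modeField (M a k : ℝ) (n : ℤ) (R S : ℝ → ℂ) :
    dTheta (modeField M a k n R S) = modeField M a k n R (deriv S) := by
  funext t r θ φ
  unfold dTheta modeField
  rw [deriv_mul_const_field, deriv_const_mul_field]

theorem opA_modeField {M a k : ℝ} (h : Admissible M a k) (n : ℤ) (R S : ℝ → ℂ) :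
    opA a (modeField M a k n R S)
      = modeField M a k n (fun r => -(Complex.I * n * corot M a k r) * R r) S := by
  funext t r θ φ
  have hp := h.rPlus_pos
  have ha : (a : ℂ) = omegaPlus M a k * (rPlus M a k ^ 2 + a ^ 2) := by
    have : a = omegaPlus M a k * (rPlus M a k ^ 2 + a ^ 2) := by
      unfold omegaPlus; field_simp
    exact_mod_cast this
  have hc : ((corot M a k r : ℝ) : ℂ)
      = (omegaPlus M a k : ℂ) * (r ^ 2 + a ^ 2) - a := by
    rw [corot]
    push_cast
    linear_combination ha
  unfold opA
  rw [dPhi_modeField, dT_modeField]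
  simp only [modeField]
  rw [hc]
  push_cast
  ring

theorem opB_modeField (M a k : ℝ) (n : ℤ) (R S : ℝ → ℂ) :
    opB a (modeField M a k n R S)
      = modeField M a k n R (fun θ => Complex.I * n * angFreq M a k θ * S θ) := by
  funext t r θ φ
  unfold opB
  rw [dPhi_modeField, dT_modeField]
  simp only [modeField, angFreq]
  push_cast
  ring

/-- The radial part of `Σ` times the Teukolsky operator on a separated field. -/
noncomputable def radialOp (M a k : ℝ) (σ n : ℤ) (R : ℝ → ℂ) (r : ℝ) : ℂ :=
  deriv (fun r => (Delta M a k r : ℂ) * deriv R r) r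
    + ((Xi a k ^ 2 * n ^ 2 * corot M a k r ^ 2 / Delta M a k r : ℝ) : ℂ) * R r
    + ((2 * σ * deriv (Delta M a k) r : ℝ) : ℂ) * deriv R r
    + Complex.I * σ * n * ((8 * Xi a k * r * omegaPlus M a k
        - 2 * Xi a k * deriv (Delta M a k) r * corot M a k r / Delta M a k r : ℝ) : ℂ) * R r
    + ((6 * k ^ 2 * r ^ 2 + (1 + σ) * deriv (deriv (Delta M a k)) r : ℝ) : ℂ) * R r

/-- The zeroth order coefficient of the angular equation, for `q = σ n`. -/
noncomputable def angPot (M a k : ℝ) (q : ℝ) (θ : ℝ) : ℝ :=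
  Xi a k ^ 2 * (q * angFreq M a k θ) ^ 2 / DeltaTheta a k θ
    + 4 * (Xi a k * Real.cot θ / DeltaTheta a k θ) * (1 - a ^ 2 * k ^ 2 * Real.cos (2 * θ))
        * (q * angFreq M a k θ)
    + 8 * Xi a k * a * Real.cos θ * (q * omegaPlus M a k)
    + (2 * DeltaTheta a k θ + 2 * a ^ 2 * k ^ 2
        + 4 * (Xi a k ^ 2 * Real.cot θ ^ 2 / DeltaTheta a k θ))

/-- The angular part of `Σ` times the Teukolsky operator on a separated field. -/
noncomputable def angularOp (M a k : ℝ) (q : ℝ) (S : ℝ → ℂ) (θ : ℝ) : ℂ :=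
  ((1 / Real.sin θ : ℝ) : ℂ)
      * deriv (fun θ => ((DeltaTheta a k θ * Real.sin θ : ℝ) : ℂ) * deriv S θ) θ
    - (angPot M a k q θ : ℂ) * S θ

theorem mul_modeField_radial (M a k : ℝ) (n : ℤ) (R S : ℝ → ℂ) (c : ℝ → ℂ) :
    (fun t r θ φ => c r * modeField M a k n R S t r θ φ)
      = modeField M a k n (fun r => c r * R r) S := by
  funext t r θ φ; simp only [modeField]; ring

theorem mul_modeField_angular (M a k : ℝ) (n : ℤ) (R S : ℝ → ℂ) (c : ℝ → ℂ) :
    (fun t r θ φ => c θ * modeField M a k n R S t r θ φ)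
      = modeField M a k n R (fun θ => c θ * S θ) := by
  funext t r θ φ; simp only [modeField]; ring

theorem DeltaTheta_pos {M a k : ℝ} (h : Admissible M a k) (θ : ℝ) : 0 < DeltaTheta a k θ := by
  obtain ⟨-, hk, ha, hak, -⟩ := h
  have h0 : 0 ≤ a * k := by positivity
  have h1 : (a * k) ^ 2 < 1 := by nlinarith
  have h2 := Real.cos_sq_le_one θ
  have h3 : 0 ≤ Real.cos θ ^ 2 := sq_nonneg _
  unfold DeltaTheta
  nlinarith

theorem teukolsky_modeField {M a k : ℝ} (h : Admissible M a k) {σ : ℤ} (hσ : σ = 1 ∨ σ = -1)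
    (m : ℤ) (R S : ℝ → ℂ) {t r θ φ : ℝ} (hr : rPlus M a k < r) (h0 : 0 < θ) (hpi : θ < Real.pi) :
    teukolsky M a k σ (modeField M a k (σ * m) R S) t r θ φ
      = ((1 / Sigma a r θ : ℝ) : ℂ)
        * (modeField M a k (σ * m) (radialOp M a k σ (σ * m) R) S t r θ φ
          + modeField M a k (σ * m) R (angularOp M a k m S) t r θ φ) := by
  have hD : (Delta M a k r : ℂ) ≠ 0 := by exact_mod_cast (h.Delta_pos hr).ne'
  have hT : (DeltaTheta a k θ : ℂ) ≠ 0 := by exact_mod_cast (DeltaTheta_pos h θ).ne'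
  have hs : (Real.sin θ : ℂ) ≠ 0 := by
    exact_mod_cast (Real.sin_pos_of_pos_of_lt_pi h0 hpi).ne'
  have hSg : (Sigma a r θ : ℂ) ≠ 0 := by
    have : 0 < Sigma a r θ := by
      have := h.rPlus_pos.trans hr
      unfold Sigma; positivity
    exact_mod_cast this.ne'
  have hσ2 : (σ : ℂ) ^ 2 = 1 := by rcases hσ with rfl | rfl <;> norm_num
  have hI := Complex.I_sq
  unfold teukolsky box
  rw [opA_modeField h, opA_modeField h, opB_modeField, opB_modeField, dTheta_modeField,
    dR_modeField, dT_modeField,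
    mul_modeField_radial (c := fun r => (Delta M a k r : ℂ)),
    mul_modeField_angular (c := fun θ => ((DeltaTheta a k θ * Real.sin θ : ℝ) : ℂ)),
    dTheta_modeField, dR_modeField]
  simp only [modeField, radialOp, angularOp, angPot]
  generalize deriv (fun θ => ((DeltaTheta a k θ * Real.sin θ : ℝ) : ℂ) * deriv S θ) θ = T
  generalize deriv (fun r => (Delta M a k r : ℂ) * deriv R r) r = U
  generalize deriv S θ = S1
  generalize deriv R r = R1
  generalize Complex.exp (-(Complex.I * (σ * m : ℤ) * omegaPlus M a k * t)) = E1
  generalize Complex.exp (Complex.I * (σ * m : ℤ) * φ) = E2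
  generalize deriv (deriv (Delta M a k)) r = D2
  generalize deriv (Delta M a k) r = D1
  push_cast
  generalize (Delta M a k r : ℂ) = D at *
  generalize (DeltaTheta a k θ : ℂ) = Th at *
  generalize (Sigma a r θ : ℂ) = Sg at *
  generalize Complex.cot (θ : ℂ) = ct at *
  generalize Complex.cos (2 * θ) = c2 at *
  generalize Complex.cos θ = c1 at *
  generalize (angFreq M a k θ : ℂ) = Y at *
  generalize (corot M a k r : ℂ) = K at *
  generalize (omegaPlus M a k : ℂ) = w at *
  generalize (Xi a k : ℂ) = X at *
  push_cast at hs
  generalize Complex.sin θ = sn at *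
  field_simp
  generalize Complex.I = J at *
  have hJ : J ^ 2 = -1 := hI
  ring_nf
  simp only [hJ, hσ2]
  ring

/-- Equality of two fields on the exterior region. -/
def ExtEq (M a k : ℝ) (f g : Field) : Prop :=
  ∀ t r θ φ : ℝ, Exterior M a k r θ → f t r θ φ = g t r θ φ

namespace ExtEq

variable {M a k : ℝ} {f g : Field}

theorem dT (H : ExtEq M a k f g) : ExtEq M a k (dT f) (dT g) := fun t r θ φ he => by
  unfold KerrAdS.dT
  exact congrArg (fun F : ℝ → ℂ => deriv F t) (funext fun t' => H t' r θ φ he)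

theorem dPhi (H : ExtEq M a k f g) : ExtEq M a k (dPhi f) (dPhi g) := fun t r θ φ he => by
  unfold KerrAdS.dPhi
  exact congrArg (fun F : ℝ → ℂ => deriv F φ) (funext fun φ' => H t r θ φ' he)

theorem dR (H : ExtEq M a k f g) : ExtEq M a k (dR f) (dR g) := fun t r θ φ he => by
  refine Filter.EventuallyEq.deriv_eq ?_
  filter_upwards [Ioi_mem_nhds he.1] with r' hr'
  exact H t r' θ φ ⟨hr', he.2⟩

theorem dTheta (H : ExtEq M a k f g) : ExtEq M a k (dTheta f) (dTheta g) :=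
  fun t r θ φ he => by
  refine Filter.EventuallyEq.deriv_eq ?_
  filter_upwards [Ioo_mem_nhds he.2.1 he.2.2] with θ' hθ'
  exact H t r θ' φ ⟨he.1, hθ'.1, hθ'.2⟩

theorem mul (c : Field) (H : ExtEq M a k f g) :
    ExtEq M a k (fun t r θ φ => c t r θ φ * f t r θ φ) (fun t r θ φ => c t r θ φ * g t r θ φ) :=
  fun t r θ φ he => by simp only [H t r θ φ he]

theorem opA (H : ExtEq M a k f g) : ExtEq M a k (opA a f) (opA a g) := fun t r θ φ he => by
  simp only [KerrAdS.opA, H.dT t r θ φ he, H.dPhi t r θ φ he]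

theorem opB (H : ExtEq M a k f g) : ExtEq M a k (opB a f) (opB a g) := fun t r θ φ he => by
  simp only [KerrAdS.opB, H.dT t r θ φ he, H.dPhi t r θ φ he]

theorem opLbar (H : ExtEq M a k f g) : ExtEq M a k (opLbar M a k f) (opLbar M a k g) :=
  fun t r θ φ he => by
  simp only [KerrAdS.opLbar, dRStar, H.dT t r θ φ he, H.dPhi t r θ φ he, H.dR t r θ φ he]

theorem opDeltaInvLbar (H : ExtEq M a k f g) :
    ExtEq M a k (opDeltaInvLbar M a k f) (opDeltaInvLbar M a k g) := fun t r θ φ he => by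
  simp only [KerrAdS.opDeltaInvLbar, H.opLbar t r θ φ he]

theorem teukolsky (σ : ℤ) (H : ExtEq M a k f g) :
    ExtEq M a k (teukolsky M a k σ f) (teukolsky M a k σ g) := fun t r θ φ he => by
  have h1 := (H.dR.mul fun _ r _ _ => (Delta M a k r : ℂ)).dR t r θ φ he
  have h2 := (H.dTheta.mul fun _ _ θ _ =>
    ((DeltaTheta a k θ * Real.sin θ : ℝ) : ℂ)).dTheta t r θ φ he
  simp only [KerrAdS.teukolsky, box, h1, h2, H.opA.opA t r θ φ he, H.opB.opB t r θ φ he,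
    H.opA t r θ φ he, H.opB t r θ φ he, H.dR t r θ φ he, H.dT t r θ φ he, H t r θ φ he]

end ExtEq

/-- A separated solution `R S` of the Teukolsky equation solves a radial and an angular equation
with a common separation constant. -/
theorem exists_separation {M a k : ℝ} (h : Admissible M a k) {σ : ℤ} (hσ : σ = 1 ∨ σ = -1)
    {m : ℤ} {R S : ℝ → ℂ} {f : Field} (hf : ExtEq M a k f (modeField M a k (σ * m) R S))
    (hT : ∀ t r θ φ : ℝ, Exterior M a k r θ → teukolsky M a k σ f t r θ φ = 0)
    {r₀ θ₀ : ℝ} (he : Exterior M a k r₀ θ₀) (hR : R r₀ ≠ 0) (hS : S θ₀ ≠ 0) :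
    ∃ lam : ℂ, (∀ r, rPlus M a k < r → radialOp M a k σ (σ * m) R r = lam * R r) ∧
      ∀ θ, 0 < θ → θ < Real.pi → angularOp M a k m S θ = -lam * S θ := by
  have key : ∀ r θ, Exterior M a k r θ →
      radialOp M a k σ (σ * m) R r * S θ + R r * angularOp M a k m S θ = 0 := by
    intro r θ hx
    have e := hT 0 r θ 0 hx
    rw [hf.teukolsky σ 0 r θ 0 hx, teukolsky_modeField h hσ m R S hx.1 hx.2.1 hx.2.2] at e
    have hSg : ((1 / Sigma a r θ : ℝ) : ℂ) ≠ 0 := by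
      have : 0 < Sigma a r θ := by
        have := h.rPlus_pos.trans hx.1
        unfold Sigma; positivity
      exact_mod_cast (one_div_pos.2 this).ne'
    have e' := (mul_eq_zero.1 e).resolve_left hSg
    simpa [modeField] using e'
  have hang : ∀ θ, 0 < θ → θ < Real.pi →
      angularOp M a k m S θ = -(radialOp M a k σ (σ * m) R r₀ / R r₀) * S θ := by
    intro θ h1 h2
    have := key r₀ θ ⟨he.1, h1, h2⟩
    field_simp
    linear_combination this
  refine ⟨radialOp M a k σ (σ * m) R r₀ / R r₀, fun r hr => ?_, hang⟩
  have h1 := key r θ₀ ⟨hr, he.2⟩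
  rw [hang θ₀ he.2.1 he.2.2] at h1
  exact mul_right_cancel₀ hS (by linear_combination h1)

/-! ### Vanishing of a monotone flux -/

theorem hasDerivAt_re_mul_conj {f g : ℝ → ℂ} {f' g' : ℂ} {x : ℝ} (hf : HasDerivAt f f' x)
    (hg : HasDerivAt g g' x) :
    HasDerivAt (fun x => (f x * (starRingEnd ℂ) (g x)).re)
      ((f' * (starRingEnd ℂ) (g x)).re + (f x * (starRingEnd ℂ) g').re) x := by
  have h1 : HasDerivAt (fun x => (starRingEnd ℂ) (g x)) ((starRingEnd ℂ) g') x :=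
    Complex.conjCLE.toContinuousLinearMap.hasFDerivAt.comp_hasDerivAt x hg
  have h2 := Complex.reCLM.hasFDerivAt.comp_hasDerivAt x (hf.mul h1)
  exact h2.congr_deriv (by simp)

/-- A function with non-negative derivative on an interval and limit `0` at both ends is constant,
so that its derivative vanishes. -/
theorem deriv_eq_zero_of_tendsto_zero {F F' : ℝ → ℝ} {s : Set ℝ} (hs : IsOpen s)
    (hconv : Convex ℝ s) (hF : ∀ x ∈ s, HasDerivAt F (F' x) x) (hF' : ∀ x ∈ s, 0 ≤ F' x)
    {l₁ l₂ : Filter ℝ} [l₁.NeBot] [l₂.NeBot] (h1 : ∀ x ∈ s, ∀ᶠ y in l₁, y ∈ s ∧ y ≤ x)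
    (h2 : ∀ x ∈ s, ∀ᶠ y in l₂, y ∈ s ∧ x ≤ y) (t1 : Tendsto F l₁ (𝓝 0))
    (t2 : Tendsto F l₂ (𝓝 0)) : ∀ x ∈ s, F' x = 0 := by
  have hmono : MonotoneOn F s := by
    refine monotoneOn_of_deriv_nonneg hconv
      (fun x hx => (hF x hx).continuousAt.continuousWithinAt)
      (fun x hx => (hF x (interior_subset hx)).differentiableAt.differentiableWithinAt)
      fun x hx => ?_
    rw [(hF x (interior_subset hx)).deriv]
    exact hF' x (interior_subset hx)
  have hzero : ∀ x ∈ s, F x = 0 := fun x hx => le_antisymm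
    (ge_of_tendsto t2 ((h2 x hx).mono fun y hy => hmono hx hy.1 hy.2))
    (le_of_tendsto t1 ((h1 x hx).mono fun y hy => hmono hy.1 hx hy.2))
  intro x hx
  refine (hF x hx).unique ((hasDerivAt_const x (0 : ℝ)).congr_of_eventuallyEq ?_)
  filter_upwards [hs.mem_nhds hx] with y hy using hzero y hy

/-! ### The angular eigenvalue -/

theorem Xi_pos {M a k : ℝ} (h : Admissible M a k) : 0 < Xi a k := by
  have := DeltaTheta_pos h 0
  simpa [DeltaTheta, Xi] using this

/-- The infimum over the sphere of the leading part of the angular potential. -/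
noncomputable def angFloor (M a k : ℝ) : ℝ :=
  Xi a k ^ 2 * (rPlus M a k ^ 2 / (rPlus M a k ^ 2 + a ^ 2)) ^ 2

theorem angFloor_pos {M a k : ℝ} (h : Admissible M a k) : 0 < angFloor M a k := by
  have := Xi_pos h
  have := h.rPlus_pos
  unfold angFloor
  positivity

theorem omegaPlus_nonneg {M a k : ℝ} (h : Admissible M a k) : 0 ≤ omegaPlus M a k := by
  have := h.2.2.1
  unfold omegaPlus; positivity

/-- For large azimuthal number the term quadratic in `q Y` absorbs the linear one, which has the
same singularity at the poles. -/
theorem exists_angPot_ge {M a k : ℝ} (h : Admissible M a k) :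
    ∃ C q₀ : ℝ, ∀ q : ℝ, q₀ ≤ |q| → ∀ θ, 0 < θ → θ < Real.pi →
      angFloor M a k * q ^ 2 - C * |q| ≤ angPot M a k q θ := by
  have hX := Xi_pos h
  have hp := h.rPlus_pos
  have ha := h.2.2.1
  have hw := omegaPlus_nonneg h
  obtain ⟨b, hb⟩ : ∃ b, b = rPlus M a k ^ 2 / (rPlus M a k ^ 2 + a ^ 2) := ⟨_, rfl⟩
  have hb0 : 0 < b := by rw [hb]; positivity
  have hb1 : 1 - a * omegaPlus M a k = b := by
    rw [hb]; unfold omegaPlus; field_simp; ring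
  have hfl : angFloor M a k = Xi a k ^ 2 * b ^ 2 := by rw [hb, angFloor]
  refine ⟨Xi a k ^ 2 * b ^ 2 * (8 / (b * Xi a k)) + 8 * Xi a k * a * omegaPlus M a k,
    8 / (b * Xi a k), fun q hq θ h0 hpi => ?_⟩
  have hs := Real.sin_pos_of_pos_of_lt_pi h0 hpi
  have hs1 := Real.sin_le_one θ
  have hT := DeltaTheta_pos h θ
  have hT1 : DeltaTheta a k θ ≤ 1 := by
    unfold DeltaTheta
    have : 0 ≤ a ^ 2 * k ^ 2 * Real.cos θ ^ 2 := by positivity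
    linarith
  -- `Y ≥ (1 - aω₊)/sin ϑ` controls both `1` and `cot ϑ`
  have hY : b / Real.sin θ ≤ angFreq M a k θ := by
    unfold angFreq
    rw [← hb1, div_le_iff₀ hs]
    have e : (1 / Real.sin θ - a * omegaPlus M a k * Real.sin θ) * Real.sin θ
        = 1 - a * omegaPlus M a k * (Real.sin θ * Real.sin θ) := by field_simp
    rw [e]
    have : Real.sin θ * Real.sin θ ≤ 1 := by nlinarith
    have h3 : 0 ≤ a * omegaPlus M a k := by positivity
    nlinarith
  have hYb : b ≤ angFreq M a k θ := by
    refine le_trans ?_ hY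
    rw [le_div_iff₀ hs]
    nlinarith
  have hY0 : 0 < angFreq M a k θ := hb0.trans_le hYb
  have hcot : |Real.cot θ| ≤ angFreq M a k θ / b := by
    rw [Real.cot_eq_cos_div_sin, abs_div, abs_of_pos hs, le_div_iff₀ hb0]
    refine le_trans ?_ hY
    rw [div_mul_eq_mul_div]
    have := Real.abs_cos_le_one θ
    gcongr
    nlinarith
  have hA1 : a ^ 2 * k ^ 2 < 1 := by unfold Xi at hX; linarith
  have hA : |1 - a ^ 2 * k ^ 2 * Real.cos (2 * θ)| ≤ 2 := by
    have h1 := Real.cos_le_one (2 * θ)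
    have h2 := Real.neg_one_le_cos (2 * θ)
    have h3 : 0 ≤ a ^ 2 * k ^ 2 := by positivity
    rw [abs_le]
    constructor <;> nlinarith
  generalize hYdef : angFreq M a k θ = Y at *
  have hlin : |4 * (Xi a k * Real.cot θ / DeltaTheta a k θ)
      * (1 - a ^ 2 * k ^ 2 * Real.cos (2 * θ)) * (q * Y)|
      ≤ (Xi a k ^ 2 * Y ^ 2 / DeltaTheta a k θ) * (8 / (b * Xi a k) * |q|) := by
    simp only [abs_mul, abs_div, abs_of_pos hX, abs_of_pos hT, abs_of_pos hY0]
    rw [abs_of_pos (by norm_num : (0 : ℝ) < 4)]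
    calc 4 * (Xi a k * |Real.cot θ| / DeltaTheta a k θ)
          * |1 - a ^ 2 * k ^ 2 * Real.cos (2 * θ)| * (|q| * Y)
        ≤ 4 * (Xi a k * (Y / b) / DeltaTheta a k θ) * 2 * (|q| * Y) := by gcongr
      _ = _ := by field_simp; ring
  have hcos : -(8 * Xi a k * a * omegaPlus M a k * |q|)
      ≤ 8 * Xi a k * a * Real.cos θ * (q * omegaPlus M a k) := by
    have h1 : |Real.cos θ * q| ≤ |q| := by
      rw [abs_mul]
      have := Real.abs_cos_le_one θ
      have := abs_nonneg q
      nlinarith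
    have h2 : -|q| ≤ Real.cos θ * q := by
      have := neg_abs_le (Real.cos θ * q); linarith
    have h3 : 0 ≤ 8 * Xi a k * a * omegaPlus M a k := by positivity
    nlinarith
  have hmain : Xi a k ^ 2 * b ^ 2 * (q ^ 2 - 8 / (b * Xi a k) * |q|)
      ≤ (Xi a k ^ 2 * Y ^ 2 / DeltaTheta a k θ) * (q ^ 2 - 8 / (b * Xi a k) * |q|) := by
    have h1 : 0 ≤ q ^ 2 - 8 / (b * Xi a k) * |q| := by
      rw [← sq_abs q]
      have := abs_nonneg q
      nlinarith
    refine mul_le_mul_of_nonneg_right ?_ h1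
    rw [le_div_iff₀ hT]
    calc Xi a k ^ 2 * b ^ 2 * DeltaTheta a k θ ≤ Xi a k ^ 2 * b ^ 2 * 1 := by gcongr
      _ ≤ Xi a k ^ 2 * Y ^ 2 := by rw [mul_one]; gcongr
  have hrest : 0 ≤ 2 * DeltaTheta a k θ + 2 * a ^ 2 * k ^ 2
      + 4 * (Xi a k ^ 2 * Real.cot θ ^ 2 / DeltaTheta a k θ) := by positivity
  have hq : Xi a k ^ 2 * (q * Y) ^ 2 / DeltaTheta a k θ
      = (Xi a k ^ 2 * Y ^ 2 / DeltaTheta a k θ) * q ^ 2 := by ring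
  unfold angPot
  rw [hfl, hYdef, hq]
  have hneg := neg_le_of_abs_le hlin
  generalize Xi a k ^ 2 * Y ^ 2 / DeltaTheta a k θ = Q at *
  generalize 8 / (b * Xi a k) = d at *
  linarith

/-- An eigenvalue of the angular equation is not below the angular potential: otherwise the flux
`Re (Δ_ϑ sin ϑ S' S̄)`, which vanishes at the poles, would be strictly increasing. -/
theorem le_re_of_angularOp {M a k q μ : ℝ} (h : Admissible M a k) {S : ℝ → ℂ} {lam : ℂ}
    (hS : ContDiffOn ℝ ∞ S (Ioo 0 Real.pi))
    (b0 : S =O[𝓝[>] 0] (fun _ => (1 : ℝ))) (b0' : deriv S =O[𝓝[>] 0] (fun _ => (1 : ℝ)))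
    (bpi : S =O[𝓝[<] Real.pi] (fun _ => (1 : ℝ)))
    (bpi' : deriv S =O[𝓝[<] Real.pi] (fun _ => (1 : ℝ)))
    (heq : ∀ θ, 0 < θ → θ < Real.pi → angularOp M a k q S θ = -lam * S θ)
    {θ₀ : ℝ} (h0 : 0 < θ₀) (hpi : θ₀ < Real.pi) (hne : S θ₀ ≠ 0)
    (hμ : ∀ θ, 0 < θ → θ < Real.pi → μ ≤ angPot M a k q θ) : μ ≤ lam.re := by
  by_contra! hlt
  have hS1 : ∀ θ ∈ Ioo 0 Real.pi, HasDerivAt S (deriv S θ) θ := fun θ hθ =>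
    ((hS.differentiableOn (by simp)).differentiableAt (isOpen_Ioo.mem_nhds hθ)).hasDerivAt
  have hS' : ContDiffOn ℝ ∞ (deriv S) (Ioo 0 Real.pi) :=
    ((contDiffOn_infty_iff_deriv_of_isOpen isOpen_Ioo).1 hS).2
  have hS2 : DifferentiableOn ℝ (deriv S) (Ioo 0 Real.pi) := hS'.differentiableOn (by simp)
  set T : ℝ → ℂ := fun θ => ((DeltaTheta a k θ * Real.sin θ : ℝ) : ℂ) * deriv S θ with hT
  have hcoef : ContDiff ℝ ∞ (fun θ => ((DeltaTheta a k θ * Real.sin θ : ℝ) : ℂ)) := by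
    refine Complex.ofRealCLM.contDiff.comp ?_
    show ContDiff ℝ ∞ fun θ => (1 - a ^ 2 * k ^ 2 * Real.cos θ ^ 2) * Real.sin θ
    have := Real.contDiff_sin (n := ∞)
    have := Real.contDiff_cos (n := ∞)
    fun_prop
  have hT1 : ∀ θ ∈ Ioo 0 Real.pi,
      HasDerivAt T ((Real.sin θ : ℂ) * ((angPot M a k q θ : ℂ) - lam) * S θ) θ := by
    intro θ hθ
    have hd : DifferentiableAt ℝ T θ :=
      (hcoef.differentiable (by simp) θ).mul (hS2.differentiableAt (isOpen_Ioo.mem_nhds hθ))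
    have e := heq θ hθ.1 hθ.2
    have hs : (Real.sin θ : ℂ) ≠ 0 := by
      exact_mod_cast (Real.sin_pos_of_pos_of_lt_pi hθ.1 hθ.2).ne'
    have e2 : deriv T θ = (Real.sin θ : ℂ) * ((angPot M a k q θ : ℂ) - lam) * S θ := by
      unfold angularOp at e
      rw [← hT] at e
      push_cast at e hs ⊢
      field_simp at e
      linear_combination e
    rw [← e2]
    exact hd.hasDerivAt
  have hF : ∀ θ ∈ Ioo 0 Real.pi, HasDerivAt (fun θ => (T θ * (starRingEnd ℂ) (S θ)).re)
      (Real.sin θ * (angPot M a k q θ - lam.re) * ‖S θ‖ ^ 2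
        + DeltaTheta a k θ * Real.sin θ * ‖deriv S θ‖ ^ 2) θ := by
    intro θ hθ
    convert hasDerivAt_re_mul_conj (hT1 θ hθ) (hS1 θ hθ) using 1
    rw [hT]
    simp only
    rw [mul_assoc _ (S θ), mul_assoc _ (deriv S θ), Complex.mul_conj, Complex.mul_conj,
      ← Complex.normSq_eq_norm_sq, ← Complex.normSq_eq_norm_sq]
    simp [-Complex.ofReal_sin]
  have hF0 : ∀ θ ∈ Ioo 0 Real.pi, 0 ≤ Real.sin θ * (angPot M a k q θ - lam.re) * ‖S θ‖ ^ 2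
        + DeltaTheta a k θ * Real.sin θ * ‖deriv S θ‖ ^ 2 := by
    intro θ hθ
    have := Real.sin_pos_of_pos_of_lt_pi hθ.1 hθ.2
    have := DeltaTheta_pos h θ
    have : 0 ≤ angPot M a k q θ - lam.re := by have := hμ θ hθ.1 hθ.2; linarith
    positivity
  -- the flux vanishes at a pole because `sin ϑ` does
  have hend : ∀ (l : Filter ℝ) (p : ℝ), l ≤ 𝓝 p → Real.sin p = 0 →
      S =O[l] (fun _ => (1 : ℝ)) → deriv S =O[l] (fun _ => (1 : ℝ)) →
      Tendsto (fun θ => (T θ * (starRingEnd ℂ) (S θ)).re) l (𝓝 0) := by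
    intro l p hl hsin hb hb'
    have hc : (fun θ => ((DeltaTheta a k θ * Real.sin θ : ℝ) : ℂ)) =o[l] (fun _ => (1 : ℝ)) := by
      rw [Asymptotics.isLittleO_one_iff]
      have := (hcoef.continuous.tendsto p).mono_left hl
      simpa [hsin] using this
    have hconj : (fun θ => (starRingEnd ℂ) (S θ)) =O[l] (fun _ => (1 : ℝ)) := by
      refine Asymptotics.IsBigO.of_norm_left ?_
      simpa using hb.norm_left
    have := (hc.mul_isBigO hb').mul_isBigO hconj
    simp only [mul_one] at this
    have h2 := (Complex.continuous_re.tendsto 0).comp ((Asymptotics.isLittleO_one_iff ℝ).1 this)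
    simpa [Function.comp_def, hT] using h2
  have hz := deriv_eq_zero_of_tendsto_zero isOpen_Ioo (convex_Ioo 0 Real.pi) hF hF0
    (l₁ := 𝓝[>] 0) (l₂ := 𝓝[<] Real.pi)
    (fun x hx => by
      filter_upwards [Ioo_mem_nhdsGT hx.1] with y hy
      exact ⟨⟨hy.1, hy.2.trans hx.2⟩, hy.2.le⟩)
    (fun x hx => by
      filter_upwards [Ioo_mem_nhdsLT hx.2] with y hy
      exact ⟨⟨hx.1.trans hy.1, hy.2⟩, hy.1.le⟩)
    (hend _ 0 nhdsWithin_le_nhds Real.sin_zero b0 b0')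
    (hend _ Real.pi nhdsWithin_le_nhds Real.sin_pi bpi bpi') θ₀ ⟨h0, hpi⟩
  have h1 := Real.sin_pos_of_pos_of_lt_pi h0 hpi
  have h2 := DeltaTheta_pos h θ₀
  have h3 : 0 < angPot M a k q θ₀ - lam.re := by have := hμ θ₀ h0 hpi; linarith
  have h4 : 0 < ‖S θ₀‖ := norm_pos_iff.2 hne
  have : 0 < Real.sin θ₀ * (angPot M a k q θ₀ - lam.re) * ‖S θ₀‖ ^ 2
        + DeltaTheta a k θ₀ * Real.sin θ₀ * ‖deriv S θ₀‖ ^ 2 := by positivity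
  linarith

/-! ### Consequences of regularity for the radial and angular profiles -/

/-- A function that agrees on one side of `p` with a function smooth across `p` is bounded there
together with its derivative. -/
theorem isBigO_one_of_eqOn {S G : ℝ → ℂ} {u s : Set ℝ} {p : ℝ} (hu : IsOpen u) (hs : IsOpen s)
    (hp : p ∈ u) (hG : ContDiffOn ℝ ∞ G u) (hSG : ∀ x ∈ s, S x = G x) {l : Filter ℝ}
    (hl : l ≤ 𝓝 p) (hls : s ∈ l) :
    S =O[l] (fun _ => (1 : ℝ)) ∧ deriv S =O[l] (fun _ => (1 : ℝ)) := by
  have h1 : Tendsto G l (𝓝 (G p)) :=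
    (hG.continuousOn.continuousAt (hu.mem_nhds hp)).tendsto.mono_left hl
  have h2 : Tendsto (deriv G) l (𝓝 (deriv G p)) :=
    ((((contDiffOn_infty_iff_deriv_of_isOpen hu).1 hG).2.continuousOn).continuousAt
      (hu.mem_nhds hp)).tendsto.mono_left hl
  refine ⟨(h1.isBigO_one ℝ).congr' ?_ .rfl, (h2.isBigO_one ℝ).congr' ?_ .rfl⟩
  · filter_upwards [hls] with x hx using (hSG x hx).symm
  · filter_upwards [hls] with x hx
    refine (Filter.EventuallyEq.deriv_eq ?_).symm
    filter_upwards [hs.mem_nhds hx] with y hy using hSG y hy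

section Profiles

variable {M a k : ℝ} {n s : ℤ} {R S : ℝ → ℂ} {f : Field}

theorem RegularUpToInfinity.angular (h : Admissible M a k)
    (hreg : RegularUpToInfinity M a k s f) (hf : ExtEq M a k f (modeField M a k n R S))
    {r₀ : ℝ} (hr₀ : rPlus M a k < r₀) (hR : R r₀ ≠ 0) :
    ContDiffOn ℝ ∞ S (Ioo 0 Real.pi) ∧
      (S =O[𝓝[>] 0] (fun _ => (1 : ℝ)) ∧ deriv S =O[𝓝[>] 0] (fun _ => (1 : ℝ))) ∧
      (S =O[𝓝[<] Real.pi] (fun _ => (1 : ℝ)) ∧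
        deriv S =O[𝓝[<] Real.pi] (fun _ => (1 : ℝ))) := by
  obtain ⟨β, ⟨N, So, hN, hSo, hβ⟩, hfβ⟩ := hreg
  have hx := rStar_nonpos h hr₀
  have hcomp : ∀ (F : ℝ × ℝ × ℂ → ℂ) (g : ℝ → ℝ) (u : Set ℝ),
      ContDiffOn ℝ ∞ F (univ ×ˢ Iic 0 ×ˢ univ) → ContDiffOn ℝ ∞ g u →
      ContDiffOn ℝ ∞ (fun θ => (R r₀)⁻¹ * F (0, rStar M a k r₀, (g θ : ℂ))) u := by
    intro F g u hF hg
    refine contDiffOn_const.mul (hF.comp (contDiffOn_const.prodMk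
      (contDiffOn_const.prodMk (Complex.ofRealCLM.contDiff.comp_contDiffOn hg))) ?_)
    intro θ _
    exact ⟨mem_univ _, hx, mem_univ _⟩
  have hval : ∀ θ ∈ Ioo 0 Real.pi, R r₀ * S θ = β 0 (rStar M a k r₀) θ 0 := by
    intro θ hθ
    rw [← hfβ 0 r₀ θ 0 ⟨hr₀, hθ⟩, hf 0 r₀ θ 0 ⟨hr₀, hθ⟩]
    simp [modeField]
  have hSN : ∀ θ ∈ Ioo 0 Real.pi,
      S θ = (R r₀)⁻¹ * N (0, rStar M a k r₀, (Real.tan (θ / 2) : ℂ)) := by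
    intro θ hθ
    have h1 := (hβ 0 (rStar M a k r₀) θ 0 hx hθ.1 hθ.2).1
    rw [← hval θ hθ] at h1
    simp only [Complex.ofReal_zero, mul_zero, Complex.exp_zero, one_mul, mul_one] at h1
    rw [← h1, inv_mul_cancel_left₀ hR]
  have hSS : ∀ θ ∈ Ioo 0 Real.pi,
      S θ = (R r₀)⁻¹ * So (0, rStar M a k r₀, (Real.cot (θ / 2) : ℂ)) := by
    intro θ hθ
    have h1 := (hβ 0 (rStar M a k r₀) θ 0 hx hθ.1 hθ.2).2
    rw [← hval θ hθ] at h1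
    simp only [Complex.ofReal_zero, mul_zero, Complex.exp_zero, one_mul, mul_one, neg_zero] at h1
    rw [← h1, inv_mul_cancel_left₀ hR]
  have hpi := Real.pi_pos
  have htan : ContDiffOn ℝ ∞ (fun θ : ℝ => Real.tan (θ / 2)) (Ioo (-Real.pi) Real.pi) := by
    intro θ hθ
    have hc : Real.cos (θ / 2) ≠ 0 := by
      refine (Real.cos_pos_of_mem_Ioo ⟨?_, ?_⟩).ne' <;> linarith [hθ.1, hθ.2]
    exact ((Real.contDiffAt_tan.2 hc).comp θ (contDiffAt_id.div_const 2)).contDiffWithinAt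
  have hcot : ContDiffOn ℝ ∞ (fun θ : ℝ => Real.cot (θ / 2)) (Ioo 0 (2 * Real.pi)) := by
    have : (fun θ : ℝ => Real.cot (θ / 2)) = fun θ => Real.cos (θ / 2) / Real.sin (θ / 2) := by
      funext θ; exact Real.cot_eq_cos_div_sin _
    rw [this]
    refine ContDiffOn.div ?_ ?_ fun θ hθ => ?_
    · exact (Real.contDiff_cos.comp (contDiff_id.div_const 2)).contDiffOn
    · exact (Real.contDiff_sin.comp (contDiff_id.div_const 2)).contDiffOn
    · refine (Real.sin_pos_of_pos_of_lt_pi ?_ ?_).ne' <;> linarith [hθ.1, hθ.2]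
  have gN := hcomp N _ _ hN htan
  have gS := hcomp So _ _ hSo hcot
  refine ⟨(gN.mono (Ioo_subset_Ioo_left (by linarith))).congr hSN, ?_, ?_⟩
  · exact isBigO_one_of_eqOn isOpen_Ioo isOpen_Ioo ⟨by linarith, hpi⟩ gN hSN
      nhdsWithin_le_nhds (Ioo_mem_nhdsGT hpi)
  · exact isBigO_one_of_eqOn isOpen_Ioo isOpen_Ioo ⟨hpi, by linarith⟩ gS hSS
      nhdsWithin_le_nhds (Ioo_mem_nhdsLT hpi)

theorem RegularUpToInfinity.radial (h : Admissible M a k) (hHR : HawkingReall M a k)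
    (hreg : RegularUpToInfinity M a k s f) (hf : ExtEq M a k f (modeField M a k n R S))
    {θ₀ : ℝ} (h0 : 0 < θ₀) (hpi : θ₀ < Real.pi) (hS : S θ₀ ≠ 0) :
    ContDiffOn ℝ ∞ R (Ioi (rPlus M a k)) ∧ (∃ L, Tendsto R atTop (𝓝 L)) ∧
      ∃ L, Tendsto (fun r => ((Delta M a k r / (r ^ 2 + a ^ 2) : ℝ) : ℂ) * deriv R r)
        atTop (𝓝 L) := by
  obtain ⟨β, ⟨N, So, hN, -, hβ⟩, hfβ⟩ := hreg
  set g : ℝ → ℂ := fun x => (S θ₀)⁻¹ * N (0, x, (Real.tan (θ₀ / 2) : ℂ)) with hg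
  have hgc : ContDiffOn ℝ ∞ g (Iic 0) := by
    refine contDiffOn_const.mul (hN.comp (contDiffOn_const.prodMk
      (contDiffOn_id.prodMk contDiffOn_const)) ?_)
    intro x hx
    exact ⟨mem_univ _, hx, mem_univ _⟩
  have hRg : ∀ r ∈ Ioi (rPlus M a k), R r = g (rStar M a k r) := by
    intro r hr
    have hx := rStar_nonpos h hr
    have h1 := (hβ 0 (rStar M a k r) θ₀ 0 hx h0 hpi).1
    rw [← hfβ 0 r θ₀ 0 ⟨hr, h0, hpi⟩, hf 0 r θ₀ 0 ⟨hr, h0, hpi⟩] at h1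
    simp only [modeField, Complex.ofReal_zero, mul_zero, Complex.exp_zero, one_mul, mul_one,
      neg_zero] at h1
    simp only [hg]
    rw [← h1]
    field_simp
  have hmaps : MapsTo (rStar M a k) (Ioi (rPlus M a k)) (Iic 0) := fun r hr => rStar_nonpos h hr
  have hlim : Tendsto (rStar M a k) atTop (𝓝[≤] 0) :=
    tendsto_nhdsWithin_iff.2 ⟨tendsto_rStar_atTop h hHR, by
      filter_upwards [Ioi_mem_atTop (rPlus M a k)] with r hr using hmaps hr⟩
  refine ⟨((hgc.comp (contDiffOn_rStar h hHR) hmaps).congr hRg), ⟨g 0, ?_⟩,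
    ⟨derivWithin g (Iic 0) 0, ?_⟩⟩
  · have h1 : Tendsto g (𝓝[≤] 0) (𝓝 (g 0)) := hgc.continuousOn 0 (mem_Iic.2 le_rfl)
    refine (h1.comp hlim).congr' ?_
    filter_upwards [Ioi_mem_atTop (rPlus M a k)] with r hr using (hRg r hr).symm
  · have h1 : Tendsto (derivWithin g (Iic 0)) (𝓝[≤] 0) (𝓝 (derivWithin g (Iic 0) 0)) :=
      hgc.continuousOn_derivWithin (uniqueDiffOn_Iic 0) (by simp) 0 (mem_Iic.2 le_rfl)
    refine (h1.comp hlim).congr' ?_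
    filter_upwards [Ioi_mem_atTop (rPlus M a k)] with r hr
    have hd : HasDerivWithinAt g (derivWithin g (Iic 0) (rStar M a k r)) (Iic 0)
        (rStar M a k r) :=
      ((hgc.differentiableOn (by simp)) _ (hmaps hr)).hasDerivWithinAt
    have h2 := hd.scomp r (hasDerivAt_rStar h hHR hr).hasDerivWithinAt hmaps
    have h3 : HasDerivAt R (((r ^ 2 + a ^ 2) / Delta M a k r)
        • derivWithin g (Iic 0) (rStar M a k r)) r :=
      (h2.hasDerivAt (Ioi_mem_nhds hr)).congr_of_eventuallyEq
        (by filter_upwards [Ioi_mem_nhds hr] with y hy using hRg y hy)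
    have hD := (h.Delta_pos hr).ne'
    have hP : r ^ 2 + a ^ 2 ≠ 0 := by
      have := h.rPlus_pos.trans hr
      positivity
    rw [h3.deriv, Function.comp, Complex.real_smul, ← mul_assoc, ← Complex.ofReal_mul]
    rw [show Delta M a k r / (r ^ 2 + a ^ 2) * ((r ^ 2 + a ^ 2) / Delta M a k r) = 1 by
      field_simp]
    simp

end Profiles

/-! ### The radial equation -/

theorem hasDerivAt_Delta (M a k r : ℝ) : HasDerivAt (Delta M a k) (deriv (Delta M a k) r) r :=
  ((contDiff_Delta M a k).differentiable (by simp) r).hasDerivAt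

theorem deriv_Delta (M a k : ℝ) : deriv (Delta M a k)
    = fun r => 4 * k ^ 2 * r ^ 3 + 2 * (1 + a ^ 2 * k ^ 2) * r - 2 * M := by
  funext r
  have h1 := (hasDerivAt_id r).pow 2
  have h : HasDerivAt (Delta M a k) _ r :=
    ((h1.add_const (a ^ 2)).mul ((h1.const_mul (k ^ 2)).const_add 1)).sub
      ((hasDerivAt_id r).const_mul (2 * M))
  rw [h.deriv]
  simp
  ring

theorem hasDerivAt_deriv_Delta (M a k r : ℝ) :
    HasDerivAt (deriv (Delta M a k)) (12 * k ^ 2 * r ^ 2 + 2 * (1 + a ^ 2 * k ^ 2)) r := by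
  rw [deriv_Delta]
  have h := ((((hasDerivAt_id r).pow 3).const_mul (4 * k ^ 2)).add
    ((hasDerivAt_id r).const_mul (2 * (1 + a ^ 2 * k ^ 2)))).sub_const (2 * M)
  refine h.congr_deriv ?_
  simp
  ring

theorem deriv_deriv_Delta (M a k r : ℝ) :
    deriv (deriv (Delta M a k)) r = 12 * k ^ 2 * r ^ 2 + 2 * (1 + a ^ 2 * k ^ 2) :=
  (hasDerivAt_deriv_Delta M a k r).deriv

/-- The part of the real radial potential that does not depend on the mode. -/
noncomputable def staticPot (M a k r : ℝ) : ℝ :=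
  deriv (Delta M a k) r ^ 2 / Delta M a k r
    + (Delta M a k r + r * deriv (Delta M a k) r) / (r ^ 2 + a ^ 2)
    - 3 * r ^ 2 * Delta M a k r / (r ^ 2 + a ^ 2) ^ 2
    - (12 * k ^ 2 * r ^ 2 + 2 * (1 + a ^ 2 * k ^ 2)) - 6 * k ^ 2 * r ^ 2

/-- The potential `W` of the renormalised radial equation
`(r² + a²) ∂_r ∂_{r⋆} A = W A`, which is the same for both signs of the spin. -/
noncomputable def radialPot (M a k : ℝ) (m : ℤ) (lam : ℂ) (r : ℝ) : ℂ :=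
  lam + ((staticPot M a k r - Xi a k ^ 2 * m ^ 2 * corot M a k r ^ 2 / Delta M a k r : ℝ) : ℂ)
    + Complex.I * ((m * (2 * Xi a k * deriv (Delta M a k) r * corot M a k r / Delta M a k r
      - 8 * Xi a k * r * omegaPlus M a k) : ℝ) : ℂ)

theorem hasDerivAt_normalisation {M a k r : ℝ} (h : Admissible M a k) (σ : ℤ)
    (hr : rPlus M a k < r) :
    HasDerivAt (fun r => Delta M a k r ^ (-σ) * (Real.sqrt (r ^ 2 + a ^ 2))⁻¹)
      (Delta M a k r ^ (-σ) * (Real.sqrt (r ^ 2 + a ^ 2))⁻¹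
        * (-σ * deriv (Delta M a k) r / Delta M a k r - r / (r ^ 2 + a ^ 2))) r := by
  have hD := h.Delta_pos hr
  have hr0 : 0 < r := h.rPlus_pos.trans hr
  have hP : 0 < r ^ 2 + a ^ 2 := by positivity
  have hsq := Real.sqrt_pos.2 hP
  have h1 := (hasDerivAt_zpow (-σ) (Delta M a k r) (Or.inl hD.ne')).comp r
    (hasDerivAt_Delta M a k r)
  have h2 := ((((hasDerivAt_id r).pow 2).add_const (a ^ 2)).sqrt hP.ne').inv hsq.ne'
  refine (h1.mul h2).congr_deriv ?_
  have h3 : Delta M a k r ^ (-σ - 1) = Delta M a k r ^ (-σ) / Delta M a k r :=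
    zpow_sub_one₀ hD.ne' _
  have h4 : Real.sqrt (r ^ 2 + a ^ 2) ^ 2 = r ^ 2 + a ^ 2 := Real.sq_sqrt hP.le
  simp only [Function.comp, id, Pi.inv_apply, Pi.pow_apply, h3]
  generalize Delta M a k r ^ (-σ) = z
  simp only [h4]
  push_cast
  field_simp
  ring

/-- The Teukolsky radial equation, written for the renormalised profile `A` and its
`r⋆`-derivative. -/
theorem hasDerivAt_tortoiseDeriv {M a k : ℝ} (h : Admissible M a k) {σ : ℤ}
    (hσ : σ = 1 ∨ σ = -1) {m : ℤ} {A : ℝ → ℂ} {lam : ℂ}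
    (hA : ContDiffOn ℝ ∞ A (Ioi (rPlus M a k)))
    (heq : ∀ r, rPlus M a k < r → radialOp M a k σ (σ * m)
      (fun r => ((Delta M a k r ^ (-σ) * (Real.sqrt (r ^ 2 + a ^ 2))⁻¹ : ℝ) : ℂ) * A r) r
        = lam * (((Delta M a k r ^ (-σ) * (Real.sqrt (r ^ 2 + a ^ 2))⁻¹ : ℝ) : ℂ) * A r))
    {r : ℝ} (hr : rPlus M a k < r) :
    HasDerivAt (fun r => ((Delta M a k r / (r ^ 2 + a ^ 2) : ℝ) : ℂ) * deriv A r)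
      (radialPot M a k m lam r / ((r ^ 2 + a ^ 2 : ℝ) : ℂ) * A r) r := by
  have hA1 : ∀ r ∈ Ioi (rPlus M a k), HasDerivAt A (deriv A r) r := fun r hr =>
    ((hA.differentiableOn (by simp)).differentiableAt (isOpen_Ioi.mem_nhds hr)).hasDerivAt
  have hA' : ContDiffOn ℝ ∞ (deriv A) (Ioi (rPlus M a k)) :=
    ((contDiffOn_infty_iff_deriv_of_isOpen isOpen_Ioi).1 hA).2
  have hA2 : HasDerivAt (deriv A) (deriv (deriv A) r) r :=
    ((hA'.differentiableOn (by simp)).differentiableAt (isOpen_Ioi.mem_nhds hr)).hasDerivAt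
  set ψ : ℝ → ℝ := fun r => Delta M a k r ^ (-σ) * (Real.sqrt (r ^ 2 + a ^ 2))⁻¹ with hψ
  set ρ : ℝ → ℝ := fun r => -σ * deriv (Delta M a k) r / Delta M a k r - r / (r ^ 2 + a ^ 2)
    with hρ
  have hψ1 : ∀ r ∈ Ioi (rPlus M a k), HasDerivAt ψ (ψ r * ρ r) r := fun r hr =>
    hasDerivAt_normalisation h σ hr
  have hD := h.Delta_pos hr
  have hr0 : 0 < r := h.rPlus_pos.trans hr
  have hP : 0 < r ^ 2 + a ^ 2 := by positivity
  have hP1 : HasDerivAt (fun r : ℝ => r ^ 2 + a ^ 2) (2 * r) r :=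
    (((hasDerivAt_id r).pow 2).add_const (a ^ 2)).congr_deriv (by simp)
  have hD1 := hasDerivAt_Delta M a k r
  have hD2 := hasDerivAt_deriv_Delta M a k r
  have hρ1 := ((hD2.const_mul (-σ : ℝ)).div hD1 hD.ne').sub ((hasDerivAt_id r).div hP1 hP.ne')
  have hψpos : 0 < ψ r := by
    have := Real.sqrt_pos.2 hP
    simp only [hψ]; positivity
  -- the derivative of the twisted flux `Δ (ψ A)' = ψ (Δ ρ A + Δ A')`
  have hflux : deriv (fun r => (Delta M a k r : ℂ) * deriv (fun r => (ψ r : ℂ) * A r) r) r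
      = ψ r * ((ρ r : ℂ) * (Delta M a k r * ρ r * A r + Delta M a k r * deriv A r)
        + deriv (Delta M a k) r * (ρ r * A r + deriv A r)
        + Delta M a k r * (((-σ * (12 * k ^ 2 * r ^ 2 + 2 * (1 + a ^ 2 * k ^ 2)) * Delta M a k r
            - -σ * deriv (Delta M a k) r * deriv (Delta M a k) r) / Delta M a k r ^ 2
            - (1 * (r ^ 2 + a ^ 2) - r * (2 * r)) / (r ^ 2 + a ^ 2) ^ 2 : ℝ) * A r
          + ρ r * deriv A r + deriv (deriv A) r)) := by
    have he : (fun r => (Delta M a k r : ℂ) * deriv (fun r => (ψ r : ℂ) * A r) r) =ᶠ[𝓝 r]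
        fun r => (Delta M a k r : ℂ) * ((ψ r : ℂ) * ((ρ r : ℂ) * A r + deriv A r)) := by
      filter_upwards [Ioi_mem_nhds hr] with x hx
      rw [show deriv (fun r => (ψ r : ℂ) * A r) x = _ from
        ((hψ1 x hx).ofReal_comp.mul (hA1 x hx)).deriv]
      push_cast
      ring
    rw [he.deriv_eq]
    refine (hD1.ofReal_comp.mul ((hψ1 r hr).ofReal_comp.mul
      ((hρ1.ofReal_comp.mul (hA1 r hr)).add hA2))).deriv.trans ?_
    simp only [id, Pi.mul_apply, Pi.add_apply, Pi.sub_apply, Pi.div_apply, hρ]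
    push_cast
    ring
  have hψA : deriv (fun r => (ψ r : ℂ) * A r) r = ψ r * (ρ r * A r + deriv A r) := by
    rw [show deriv (fun r => (ψ r : ℂ) * A r) r = _ from
      ((hψ1 r hr).ofReal_comp.mul (hA1 r hr)).deriv]
    push_cast
    ring
  have e : radialOp M a k σ (σ * m) (fun r => (ψ r : ℂ) * A r) r = lam * (ψ r * A r) := heq r hr
  unfold radialOp at e
  rw [hflux, hψA, deriv_deriv_Delta] at e
  have hψc : (ψ r : ℂ) ≠ 0 := by exact_mod_cast hψpos.ne'
  have hDc : (Delta M a k r : ℂ) ≠ 0 := by exact_mod_cast hD.ne'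
  have hPc : (r : ℂ) ^ 2 + (a : ℂ) ^ 2 ≠ 0 := by exact_mod_cast hP.ne'
  refine (((hD1.div hP1 hP.ne').ofReal_comp).mul hA2).congr_deriv ?_
  simp only [radialPot, staticPot, hρ, Pi.div_apply] at e ⊢
  clear_value ψ
  generalize deriv (deriv A) r = A2 at *
  generalize deriv A r = A1 at *
  generalize A r = A0 at *
  generalize ψ r = ψ0 at *
  generalize deriv (Delta M a k) r = D1 at *
  push_cast at e ⊢
  generalize (Delta M a k r : ℂ) = D at *
  generalize (corot M a k r : ℂ) = κ at *
  generalize (omegaPlus M a k : ℂ) = w at *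
  generalize (Xi a k : ℂ) = X at *
  generalize Complex.I = J at *
  rcases hσ with rfl | rfl
  · push_cast at e
    field_simp at e ⊢
    linear_combination e
  · push_cast at e
    field_simp at e ⊢
    linear_combination e

/-! ### Positivity of the radial potential -/

/-- The radial half of the statement that the horizon generator is timelike in the exterior:
`κ²/Δ ≤ ω₊²/k²`. -/
theorem HawkingReall.sq_le_Delta {M a k r : ℝ} (h : Admissible M a k) (hHR : HawkingReall M a k)
    (hr : rPlus M a k < r) : k ^ 2 * (r ^ 2 - rPlus M a k ^ 2) ^ 2 ≤ Delta M a k r := by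
  have hp := h.rPlus_pos
  have hr0 : 0 < r := hp.trans hr
  have h1 := hHR.sq_lt h
  have h2 : a ^ 2 / rPlus M a k ≤ k ^ 2 * rPlus M a k ^ 3 := by
    rw [div_le_iff₀ hp]; linarith
  have h3 : k ^ 2 * (r - rPlus M a k) * (r + rPlus M a k) ^ 2 ≤ slope M a k r := by
    have h4 : 0 ≤ k ^ 2 * r * rPlus M a k ^ 2 := by positivity
    have h5 : 0 ≤ (1 + a ^ 2 * k ^ 2) * r := by positivity
    unfold slope
    nlinarith
  rw [h.Delta_eq]
  calc k ^ 2 * (r ^ 2 - rPlus M a k ^ 2) ^ 2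
      = (r - rPlus M a k) * (k ^ 2 * (r - rPlus M a k) * (r + rPlus M a k) ^ 2) := by ring
    _ ≤ _ := by gcongr

theorem exists_staticPot_ge {M a k : ℝ} (h : Admissible M a k) :
    ∃ C : ℝ, ∀ r, rPlus M a k < r → -C ≤ staticPot M a k r := by
  have hp := h.rPlus_pos
  have hM := h.1
  have hs := h.slope_rPlus_pos
  have hB : 0 ≤ 8 * M * (1 + a ^ 2 * k ^ 2) := by positivity
  refine ⟨8 * M * (1 + a ^ 2 * k ^ 2) / slope M a k (rPlus M a k) + 2 + 2 * (a ^ 2 * k ^ 2)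
    + 2 * M / rPlus M a k + 2 * (1 + a ^ 2 * k ^ 2), fun r hr => ?_⟩
  have hr0 : 0 < r := hp.trans hr
  have hD := h.Delta_pos hr
  have hP : 0 < r ^ 2 + a ^ 2 := by positivity
  have hroot : Delta M a k (rPlus M a k) = 0 := by rw [h.Delta_eq]; simp
  -- `Δ'² - 16k²r²Δ` is the square `Δ'(r₊)²` at the horizon, and grows apart from one linear term
  have hq : -(8 * M * (1 + a ^ 2 * k ^ 2) * (r - rPlus M a k))
      ≤ deriv (Delta M a k) r ^ 2 - 16 * k ^ 2 * r ^ 2 * Delta M a k r := by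
    have h0 : 0 ≤ deriv (Delta M a k) (rPlus M a k) ^ 2
        - 16 * k ^ 2 * rPlus M a k ^ 2 * Delta M a k (rPlus M a k) := by
      rw [hroot, mul_zero, sub_zero]; positivity
    have e : ∀ x, deriv (Delta M a k) x ^ 2 - 16 * k ^ 2 * x ^ 2 * Delta M a k x
        = 16 * k ^ 2 * M * x ^ 3 + 4 * (1 - a ^ 2 * k ^ 2) ^ 2 * x ^ 2
          - 8 * M * (1 + a ^ 2 * k ^ 2) * x + 4 * M ^ 2 := by
      intro x; rw [deriv_Delta]; unfold Delta; ring
    rw [e] at h0 ⊢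
    have h3 : 16 * k ^ 2 * M * rPlus M a k ^ 3 ≤ 16 * k ^ 2 * M * r ^ 3 := by gcongr
    have h4 : 4 * (1 - a ^ 2 * k ^ 2) ^ 2 * rPlus M a k ^ 2
        ≤ 4 * (1 - a ^ 2 * k ^ 2) ^ 2 * r ^ 2 := by gcongr
    linarith
  have h1 : 16 * k ^ 2 * r ^ 2 - 8 * M * (1 + a ^ 2 * k ^ 2) / slope M a k (rPlus M a k)
      ≤ deriv (Delta M a k) r ^ 2 / Delta M a k r := by
    rw [le_div_iff₀ hD]
    have hle : (r - rPlus M a k) * slope M a k (rPlus M a k) ≤ Delta M a k r := by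
      rw [h.Delta_eq]
      have := h.slope_rPlus_le hr.le
      gcongr
    have h2 : 8 * M * (1 + a ^ 2 * k ^ 2) * (r - rPlus M a k)
        ≤ 8 * M * (1 + a ^ 2 * k ^ 2) / slope M a k (rPlus M a k) * Delta M a k r := by
      rw [div_mul_eq_mul_div, le_div_iff₀ hs]
      nlinarith
    linarith
  have h2 : 2 * k ^ 2 * r ^ 2 - 2 - 2 * (a ^ 2 * k ^ 2) - 2 * M / rPlus M a k
      ≤ (Delta M a k r + r * deriv (Delta M a k) r) / (r ^ 2 + a ^ 2)
        - 3 * r ^ 2 * Delta M a k r / (r ^ 2 + a ^ 2) ^ 2 := by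
    have e : (Delta M a k r + r * deriv (Delta M a k) r) / (r ^ 2 + a ^ 2)
        - 3 * r ^ 2 * Delta M a k r / (r ^ 2 + a ^ 2) ^ 2
        = 2 * k ^ 2 * r ^ 2 - 2 - 2 * (a ^ 2 * k ^ 2)
          + 2 * r ^ 2 / (r ^ 2 + a ^ 2) + 2 * (a ^ 2 * k ^ 2) * a ^ 2 / (r ^ 2 + a ^ 2)
          + 4 * M * r / (r ^ 2 + a ^ 2) - 2 * M * r / (r ^ 2 + a ^ 2)
          + 3 * a ^ 2 * Delta M a k r / (r ^ 2 + a ^ 2) ^ 2 := by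
      rw [deriv_Delta]; unfold Delta; field_simp; ring
    have h5 : 2 * M * r / (r ^ 2 + a ^ 2) ≤ 2 * M / rPlus M a k := by
      rw [div_le_div_iff₀ hP hp]
      have : rPlus M a k * r ≤ r ^ 2 + a ^ 2 := by nlinarith [sq_nonneg a]
      nlinarith
    rw [e]
    have : 0 ≤ 2 * r ^ 2 / (r ^ 2 + a ^ 2) := by positivity
    have : 0 ≤ 2 * (a ^ 2 * k ^ 2) * a ^ 2 / (r ^ 2 + a ^ 2) := by positivity
    have : 0 ≤ 4 * M * r / (r ^ 2 + a ^ 2) := by positivity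
    have : 0 ≤ 3 * a ^ 2 * Delta M a k r / (r ^ 2 + a ^ 2) ^ 2 := by positivity
    linarith
  unfold staticPot
  linarith

theorem corot_term_le {M a k r : ℝ} (h : Admissible M a k) (hHR : HawkingReall M a k)
    (hr : rPlus M a k < r) (q : ℝ) :
    Xi a k ^ 2 * q ^ 2 * corot M a k r ^ 2 / Delta M a k r
      ≤ Xi a k ^ 2 * omegaPlus M a k ^ 2 / k ^ 2 * q ^ 2 := by
  have hk := h.2.1
  rw [div_le_iff₀ (h.Delta_pos hr)]
  unfold corot
  have h1 := hHR.sq_le_Delta h hr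
  calc Xi a k ^ 2 * q ^ 2 * (omegaPlus M a k * (r ^ 2 - rPlus M a k ^ 2)) ^ 2
      = Xi a k ^ 2 * omegaPlus M a k ^ 2 / k ^ 2 * q ^ 2
        * (k ^ 2 * (r ^ 2 - rPlus M a k ^ 2) ^ 2) := by field_simp
    _ ≤ _ := by gcongr

/-- The other half: the bound on the rotational term lies strictly below the angular term. -/
theorem HawkingReall.lt_angFloor {M a k : ℝ} (h : Admissible M a k) (hHR : HawkingReall M a k) :
    Xi a k ^ 2 * omegaPlus M a k ^ 2 / k ^ 2 < angFloor M a k := by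
  have hk := h.2.1
  have hX := Xi_pos h
  have hp := h.rPlus_pos
  have h1 := hHR.sq_lt h
  unfold angFloor omegaPlus
  rw [div_lt_iff₀ (by positivity), div_pow, div_pow, mul_assoc]
  have : a ^ 2 / (rPlus M a k ^ 2 + a ^ 2) ^ 2
      < (rPlus M a k ^ 2) ^ 2 / (rPlus M a k ^ 2 + a ^ 2) ^ 2 * k ^ 2 := by
    rw [div_mul_eq_mul_div]
    gcongr
    linarith
  gcongr

/-! ### Regularity at the horizon -/

/-- The action of `Δ⁻¹ L̲` on the radial profile of a separated field. -/
noncomputable def horizonOp (M a k : ℝ) (n : ℤ) (V : ℝ → ℂ) (r : ℝ) : ℂ :=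
  (((Delta M a k r)⁻¹ : ℝ) : ℂ) *
    ((Xi a k * -(Complex.I * n * omegaPlus M a k)
        + ((a * Xi a k / (r ^ 2 + a ^ 2) : ℝ) : ℂ) * (Complex.I * n)) * V r
      - ((Delta M a k r / (r ^ 2 + a ^ 2) : ℝ) : ℂ) * deriv V r)

/-- `κ/Δ`, with the common zero at the horizon cancelled. -/
noncomputable def corotRatio (M a k r : ℝ) : ℝ :=
  omegaPlus M a k * (r + rPlus M a k) / slope M a k r

theorem opDeltaInvLbar_iterate_modeField (M a k : ℝ) (n : ℤ) (V S : ℝ → ℂ) (q : ℕ) :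
    (opDeltaInvLbar M a k)^[q] (modeField M a k n V S)
      = modeField M a k n ((horizonOp M a k n)^[q] V) S := by
  induction q with
  | zero => rfl
  | succ q ih =>
    rw [Function.iterate_succ_apply', ih, Function.iterate_succ_apply']
    funext t r θ φ
    unfold opDeltaInvLbar opLbar dRStar
    rw [dT_modeField, dPhi_modeField, dR_modeField]
    simp only [modeField, horizonOp]
    ring

theorem ExtEq.opDeltaInvLbar_iterate {M a k : ℝ} {f g : Field} (H : ExtEq M a k f g) (q : ℕ) :
    ExtEq M a k ((KerrAdS.opDeltaInvLbar M a k)^[q] f)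
      ((KerrAdS.opDeltaInvLbar M a k)^[q] g) := by
  induction q with
  | zero => exact H
  | succ q ih =>
    rw [Function.iterate_succ_apply', Function.iterate_succ_apply']
    exact ih.opDeltaInvLbar

theorem norm_modeField (M a k : ℝ) (n : ℤ) (V S : ℝ → ℂ) (t r θ φ : ℝ) :
    ‖modeField M a k n V S t r θ φ‖ = ‖V r‖ * ‖S θ‖ := by
  have h1 : ‖Complex.exp (-(Complex.I * n * omegaPlus M a k * t))‖ = 1 := by
    rw [Complex.norm_exp]; simp
  have h2 : ‖Complex.exp (Complex.I * n * φ)‖ = 1 := by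
    rw [Complex.norm_exp]; simp
  simp only [modeField, norm_mul, h1, h2]
  ring

theorem RegularAtHorizon.isBigO {M a k : ℝ} {σ n : ℤ} {R S : ℝ → ℂ} {f : Field}
    (hreg : RegularAtHorizon M a k σ f) (hf : ExtEq M a k f (modeField M a k n R S))
    {θ₀ : ℝ} (h0 : 0 < θ₀) (hpi : θ₀ < Real.pi) (hS : S θ₀ ≠ 0) (q : ℕ) :
    (horizonOp M a k n)^[q] (fun r => ((Delta M a k r ^ σ : ℝ) : ℂ) * R r)
      =O[𝓝[>] rPlus M a k] (fun _ => (1 : ℝ)) := by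
  obtain ⟨C, δ, hδ, hC⟩ := hreg 0 q 0
  have hS' : 0 < ‖S θ₀‖ := norm_pos_iff.2 hS
  refine Asymptotics.IsBigO.of_bound (C / ‖S θ₀‖) ?_
  filter_upwards [Ioo_mem_nhdsGT (show rPlus M a k < rPlus M a k + δ by linarith)] with r hr
  have hx : Exterior M a k r θ₀ := ⟨hr.1, h0, hpi⟩
  have h1 := hC r θ₀ 0 hx hr.2
  have h2 := (hf.mul fun _ r _ _ => ((Delta M a k r ^ σ : ℝ) : ℂ)).opDeltaInvLbar_iterate q
    (tOnSlice M a k 0 r) r θ₀ 0 hx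
  rw [mul_modeField_radial (c := fun r => ((Delta M a k r ^ σ : ℝ) : ℂ)),
    opDeltaInvLbar_iterate_modeField] at h2
  rw [Function.iterate_zero, id, h2, norm_modeField] at h1
  rw [norm_one, mul_one, le_div_iff₀ hS']
  exact h1

theorem corot_eq {M a k : ℝ} (h : Admissible M a k) {r : ℝ} (hr : rPlus M a k ≤ r) :
    corot M a k r = Delta M a k r * corotRatio M a k r := by
  have := (h.slope_pos hr).ne'
  unfold corotRatio corot
  rw [h.Delta_eq]
  field_simp
  ring

theorem deriv_eq_horizonOp {M a k : ℝ} (h : Admissible M a k) (n : ℤ) (V : ℝ → ℂ) {r : ℝ}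
    (hr : rPlus M a k < r) :
    deriv V r = -((r ^ 2 + a ^ 2 : ℝ) : ℂ) * horizonOp M a k n V r
      - Complex.I * ((Xi a k * n * corotRatio M a k r : ℝ) : ℂ) * V r := by
  have hp := h.rPlus_pos
  have hD : (Delta M a k r : ℂ) ≠ 0 := by exact_mod_cast (h.Delta_pos hr).ne'
  have hP : (r : ℂ) ^ 2 + (a : ℂ) ^ 2 ≠ 0 := by
    have : 0 < r ^ 2 + a ^ 2 := by have := hp.trans hr; positivity
    exact_mod_cast this.ne'
  have hc : (omegaPlus M a k : ℂ) * (r ^ 2 + a ^ 2) - a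
      = Delta M a k r * corotRatio M a k r := by
    have e := corot_eq h hr.le
    have : omegaPlus M a k * (r ^ 2 + a ^ 2) - a = Delta M a k r * corotRatio M a k r := by
      rw [← e]; unfold corot omegaPlus; field_simp; ring
    exact_mod_cast this
  unfold horizonOp
  push_cast
  field_simp
  linear_combination -(V r * Xi a k * n * Complex.I) * hc

theorem continuous_slope (M a k : ℝ) : Continuous (slope M a k) := by
  unfold slope; fun_prop

theorem continuousAt_corotRatio {M a k : ℝ} (h : Admissible M a k) :
    ContinuousAt (corotRatio M a k) (rPlus M a k) := by
  unfold corotRatio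
  exact ContinuousAt.div (by fun_prop) (continuous_slope M a k).continuousAt
    h.slope_rPlus_pos.ne'

theorem contDiff_slope (M a k : ℝ) : ContDiff ℝ ∞ (slope M a k) := by
  unfold slope; fun_prop

theorem contDiffOn_horizonOp {M a k : ℝ} (h : Admissible M a k) (n : ℤ) {V : ℝ → ℂ}
    (hV : ContDiffOn ℝ ∞ V (Ioi (rPlus M a k))) :
    ContDiffOn ℝ ∞ (horizonOp M a k n V) (Ioi (rPlus M a k)) := by
  have hV' : ContDiffOn ℝ ∞ (deriv V) (Ioi (rPlus M a k)) :=
    ((contDiffOn_infty_iff_deriv_of_isOpen isOpen_Ioi).1 hV).2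
  have hD : ∀ r ∈ Ioi (rPlus M a k), Delta M a k r ≠ 0 := fun r hr => (h.Delta_pos hr).ne'
  have hP : ∀ r ∈ Ioi (rPlus M a k), r ^ 2 + a ^ 2 ≠ 0 := fun r hr => by
    have : 0 < r := h.rPlus_pos.trans hr
    positivity
  have hDc := (contDiff_Delta M a k).contDiffOn (s := Ioi (rPlus M a k))
  have hPc : ContDiffOn ℝ ∞ (fun r : ℝ => r ^ 2 + a ^ 2) (Ioi (rPlus M a k)) := by fun_prop
  have hR : ∀ {F : ℝ → ℝ}, ContDiffOn ℝ ∞ F (Ioi (rPlus M a k)) →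
      ContDiffOn ℝ ∞ (fun r => (F r : ℂ)) (Ioi (rPlus M a k)) := fun hF =>
    Complex.ofRealCLM.contDiff.comp_contDiffOn hF
  refine (hR (hDc.inv hD)).mul (ContDiffOn.sub (ContDiffOn.mul ?_ hV) ?_)
  · exact contDiffOn_const.add ((hR (contDiffOn_const.div hPc hP)).mul contDiffOn_const)
  · exact (hR (hDc.div hPc hP)).mul hV'

theorem hasDerivAt_horizonOp {M a k : ℝ} (h : Admissible M a k) (n : ℤ) {V : ℝ → ℂ}
    (hV : ContDiffOn ℝ ∞ V (Ioi (rPlus M a k))) {r : ℝ} (hr : rPlus M a k < r) :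
    HasDerivAt V (-((r ^ 2 + a ^ 2 : ℝ) : ℂ) * horizonOp M a k n V r
      - Complex.I * ((Xi a k * n * corotRatio M a k r : ℝ) : ℂ) * V r) r := by
  rw [← deriv_eq_horizonOp h n V hr]
  exact ((hV.differentiableOn (by simp)).differentiableAt (isOpen_Ioi.mem_nhds hr)).hasDerivAt

theorem tendsto_Delta_rPlus {M a k : ℝ} (h : Admissible M a k) :
    Tendsto (Delta M a k) (𝓝[>] rPlus M a k) (𝓝 0) := by
  have h0 : Delta M a k (rPlus M a k) = 0 := by rw [h.Delta_eq]; simp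
  have := ((continuous_Delta M a k).tendsto (rPlus M a k)).mono_left
    (nhdsWithin_le_nhds (s := Ioi (rPlus M a k)))
  rwa [h0] at this

/-- A real coefficient that is continuous at the horizon is bounded near it. -/
theorem isBigO_one_ofReal {F : ℝ → ℝ} {p : ℝ} (hF : ContinuousAt F p) :
    (fun r => (F r : ℂ)) =O[𝓝[>] p] (fun _ => (1 : ℝ)) := by
  have h1 : Tendsto (fun r => (F r : ℂ)) (𝓝[>] p) (𝓝 (F p : ℂ)) :=
    (Complex.continuous_ofReal.tendsto _).comp (hF.tendsto.mono_left nhdsWithin_le_nhds)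
  exact h1.isBigO_one ℝ

theorem tendsto_zero_of_mul_isBigO_one {F V : ℝ → ℂ} {l : Filter ℝ} (hF : Tendsto F l (𝓝 0))
    (hV : V =O[l] (fun _ => (1 : ℝ))) : Tendsto (fun r => F r * V r) l (𝓝 0) := by
  have h1 := ((Asymptotics.isLittleO_one_iff ℝ).2 hF).mul_isBigO hV
  simp only [mul_one] at h1
  exact (Asymptotics.isLittleO_one_iff ℝ).1 h1

/-- For spin `-2` regularity forces the profile to vanish like `Δ` at the horizon. -/
theorem tendsto_flux_of_spin_neg {M a k : ℝ} (h : Admissible M a k) {n : ℤ} {A : ℝ → ℂ}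
    (hA : ContDiffOn ℝ ∞ A (Ioi (rPlus M a k)))
    (hb : ∀ q : ℕ, (horizonOp M a k n)^[q] (fun r => ((Delta M a k r ^ (-1 : ℤ) : ℝ) : ℂ) * A r)
      =O[𝓝[>] rPlus M a k] (fun _ => (1 : ℝ))) :
    Tendsto (fun r => ((Delta M a k r / (r ^ 2 + a ^ 2) : ℝ) : ℂ) * deriv A r
      * (starRingEnd ℂ) (A r)) (𝓝[>] rPlus M a k) (𝓝 0) := by
  set V : ℝ → ℂ := fun r => ((Delta M a k r ^ (-1 : ℤ) : ℝ) : ℂ) * A r with hV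
  have hD : ∀ r ∈ Ioi (rPlus M a k), Delta M a k r ≠ 0 := fun r hr => (h.Delta_pos hr).ne'
  have hVc : ContDiffOn ℝ ∞ V (Ioi (rPlus M a k)) := by
    refine ContDiffOn.mul (Complex.ofRealCLM.contDiff.comp_contDiffOn ?_) hA
    exact ((contDiff_Delta M a k).contDiffOn.inv hD).congr fun r _ => zpow_neg_one _
  have hAV : ∀ r ∈ Ioi (rPlus M a k), A r = (Delta M a k r : ℂ) * V r := by
    intro r hr
    have : (Delta M a k r : ℂ) ≠ 0 := by exact_mod_cast hD r hr
    simp only [hV, zpow_neg_one]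
    push_cast
    field_simp
  have b0 : V =O[𝓝[>] rPlus M a k] (fun _ => (1 : ℝ)) := hb 0
  have b1 : horizonOp M a k n V =O[𝓝[>] rPlus M a k] (fun _ => (1 : ℝ)) := hb 1
  have hself : Ioi (rPlus M a k) ∈ 𝓝[>] rPlus M a k := self_mem_nhdsWithin
  have bV' : deriv V =O[𝓝[>] rPlus M a k] (fun _ => (1 : ℝ)) := by
    have hP : (fun r : ℝ => ((r ^ 2 + a ^ 2 : ℝ) : ℂ)) =O[𝓝[>] rPlus M a k]
        (fun _ => (1 : ℝ)) := isBigO_one_ofReal (by fun_prop)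
    have hG : (fun r : ℝ => ((Xi a k * n * corotRatio M a k r : ℝ) : ℂ))
        =O[𝓝[>] rPlus M a k] (fun _ => (1 : ℝ)) :=
      isBigO_one_ofReal (continuousAt_const.mul (continuousAt_corotRatio h))
    have h1 := (hP.mul b1).neg_left.sub ((hG.const_mul_left Complex.I).mul b0)
    simp only [mul_one] at h1
    refine h1.congr' ?_ .rfl
    filter_upwards [hself] with r hr
    rw [deriv_eq_horizonOp h n V hr]
    ring
  -- `∂_{r⋆} A = (Δ/(r² + a²)) (Δ' V + Δ V')`
  have hA1 : ∀ r ∈ Ioi (rPlus M a k), ((Delta M a k r / (r ^ 2 + a ^ 2) : ℝ) : ℂ) * deriv A r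
      = ((Delta M a k r / (r ^ 2 + a ^ 2) : ℝ) : ℂ) * (((deriv (Delta M a k) r : ℝ) : ℂ) * V r
        + (Delta M a k r : ℂ) * deriv V r) := by
    intro r hr
    have hd := (hasDerivAt_Delta M a k r).ofReal_comp.mul
      ((hVc.differentiableOn (by simp)).differentiableAt (isOpen_Ioi.mem_nhds hr)).hasDerivAt
    rw [(hd.congr_of_eventuallyEq (by
      filter_upwards [Ioi_mem_nhds hr] with y hy using hAV y hy)).deriv]
  have hDc : ContinuousAt (Delta M a k) (rPlus M a k) := (continuous_Delta M a k).continuousAt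
  have hD'c : ContinuousAt (deriv (Delta M a k)) (rPlus M a k) :=
    (hasDerivAt_deriv_Delta M a k _).continuousAt
  have hp := h.rPlus_pos
  have hbr := ((isBigO_one_ofReal hD'c).mul b0).add ((isBigO_one_ofReal hDc).mul bV')
  have hcoef : Tendsto (fun r => ((Delta M a k r / (r ^ 2 + a ^ 2) : ℝ) : ℂ))
      (𝓝[>] rPlus M a k) (𝓝 0) := by
    have hq : Tendsto (fun r : ℝ => r ^ 2 + a ^ 2) (𝓝[>] rPlus M a k)
        (𝓝 (rPlus M a k ^ 2 + a ^ 2)) :=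
      ((by fun_prop : Continuous fun r : ℝ => r ^ 2 + a ^ 2).tendsto _).mono_left
        nhdsWithin_le_nhds
    have h1 := (tendsto_Delta_rPlus h).div hq (by positivity)
    rw [zero_div] at h1
    have h2 := (Complex.continuous_ofReal.tendsto 0).comp h1
    simpa [Function.comp_def] using h2
  have bA : A =O[𝓝[>] rPlus M a k] (fun _ => (1 : ℝ)) := by
    have h1 := (isBigO_one_ofReal hDc).mul b0
    simp only [mul_one] at h1
    refine h1.congr' ?_ .rfl
    filter_upwards [hself] with r hr using (hAV r hr).symm
  have bAc : (fun r => (starRingEnd ℂ) (A r)) =O[𝓝[>] rPlus M a k] (fun _ => (1 : ℝ)) := by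
    refine Asymptotics.IsBigO.of_norm_left ?_
    simpa using bA.norm_left
  simp only [mul_one] at hbr
  have h3 := tendsto_zero_of_mul_isBigO_one (tendsto_zero_of_mul_isBigO_one hcoef hbr) bAc
  refine h3.congr' ?_
  filter_upwards [hself] with r hr
  rw [hA1 r hr]

/-! ### Absence of resonance at the horizon for spin `+2` -/

/-- The part of `resPot` that does not depend on the mode. -/
noncomputable def resStatic (M a k r : ℝ) : ℝ :=
  Delta M a k r / (r ^ 2 + a ^ 2) - r * deriv (Delta M a k) r / (r ^ 2 + a ^ 2)
    - 3 * r ^ 2 * Delta M a k r / (r ^ 2 + a ^ 2) ^ 2 - 6 * k ^ 2 * r ^ 2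

/-- The coefficient of `im` in `resPot`. -/
noncomputable def resRot (M a k r : ℝ) : ℝ :=
  -6 * Xi a k * omegaPlus M a k * r - 2 * Xi a k * corot M a k r * r / (r ^ 2 + a ^ 2)

/-- The potential `z` of the radial equation written for `v = Δ A` and `h = Δ⁻¹ L̲ v`, where it has
no singular coefficient: `Δ h' = (Δ' + iΞmκ) h - z v / (r² + a²)`. -/
noncomputable def resPot (M a k : ℝ) (m : ℤ) (lam : ℂ) (r : ℝ) : ℂ :=
  lam + (resStatic M a k r : ℂ) + Complex.I * ((m * resRot M a k r : ℝ) : ℂ)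

/-- `Δ⁻¹ L̲ (Δ A)` in terms of `A` and `∂_{r⋆} A`. -/
theorem horizonOp_eq_flux {M a k : ℝ} (h : Admissible M a k) {m : ℤ} {A : ℝ → ℂ}
    (hA : ContDiffOn ℝ ∞ A (Ioi (rPlus M a k))) {r : ℝ} (hr : rPlus M a k < r) :
    horizonOp M a k m (fun r => (Delta M a k r : ℂ) * A r) r
      = -(((Delta M a k r / (r ^ 2 + a ^ 2) : ℝ) : ℂ) * deriv A r)
        - (((deriv (Delta M a k) r / (r ^ 2 + a ^ 2) : ℝ) : ℂ)
          + Complex.I * ((Xi a k * m * corot M a k r / (r ^ 2 + a ^ 2) : ℝ) : ℂ)) * A r := by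
  have hA1 : HasDerivAt A (deriv A r) r :=
    ((hA.differentiableOn (by simp)).differentiableAt (isOpen_Ioi.mem_nhds hr)).hasDerivAt
  have hP : (r : ℂ) ^ 2 + (a : ℂ) ^ 2 ≠ 0 := by
    have : 0 < r ^ 2 + a ^ 2 := by have := h.rPlus_pos.trans hr; positivity
    exact_mod_cast this.ne'
  have e := deriv_eq_horizonOp h m (fun r => (Delta M a k r : ℂ) * A r) hr
  rw [show deriv (fun r => (Delta M a k r : ℂ) * A r) r = _ from
    ((hasDerivAt_Delta M a k r).ofReal_comp.mul hA1).deriv] at e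
  rw [corot_eq h hr.le]
  push_cast at e ⊢
  field_simp
  linear_combination e

/-- The radial equation as a relation between `v = Δ A`, `Δ⁻¹ L̲ v` and `(Δ⁻¹ L̲)² v`. -/
theorem spin_pos_relation {M a k : ℝ} (h : Admissible M a k) {m : ℤ} {A : ℝ → ℂ} {lam : ℂ}
    (hA : ContDiffOn ℝ ∞ A (Ioi (rPlus M a k)))
    (hode : ∀ r, rPlus M a k < r →
      HasDerivAt (fun r => ((Delta M a k r / (r ^ 2 + a ^ 2) : ℝ) : ℂ) * deriv A r)
        (radialPot M a k m lam r / ((r ^ 2 + a ^ 2 : ℝ) : ℂ) * A r) r)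
    {r : ℝ} (hr : rPlus M a k < r) :
    -((Delta M a k r * (r ^ 2 + a ^ 2) : ℝ) : ℂ)
        * (horizonOp M a k m)^[2] (fun r => (Delta M a k r : ℂ) * A r) r
      = (((deriv (Delta M a k) r : ℝ) : ℂ)
          + Complex.I * ((2 * Xi a k * m * corot M a k r : ℝ) : ℂ))
          * horizonOp M a k m (fun r => (Delta M a k r : ℂ) * A r) r
        - resPot M a k m lam r / ((r ^ 2 + a ^ 2 : ℝ) : ℂ) * ((Delta M a k r : ℂ) * A r) := by
  set v : ℝ → ℂ := fun r => (Delta M a k r : ℂ) * A r with hv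
  have hvc : ContDiffOn ℝ ∞ v (Ioi (rPlus M a k)) :=
    (Complex.ofRealCLM.contDiff.comp (contDiff_Delta M a k)).contDiffOn.mul hA
  have hA1 : HasDerivAt A (deriv A r) r :=
    ((hA.differentiableOn (by simp)).differentiableAt (isOpen_Ioi.mem_nhds hr)).hasDerivAt
  have hP0 : 0 < r ^ 2 + a ^ 2 := by have := h.rPlus_pos.trans hr; positivity
  have hP : (r : ℂ) ^ 2 + (a : ℂ) ^ 2 ≠ 0 := by exact_mod_cast hP0.ne'
  have hD : (Delta M a k r : ℂ) ≠ 0 := by exact_mod_cast (h.Delta_pos hr).ne'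
  have hP1 : HasDerivAt (fun r : ℝ => r ^ 2 + a ^ 2) (2 * r) r :=
    (((hasDerivAt_id r).pow 2).add_const (a ^ 2)).congr_deriv (by simp)
  have hκ1 : HasDerivAt (corot M a k) (omegaPlus M a k * (2 * r)) r := by
    have := (((hasDerivAt_id r).pow 2).sub_const (rPlus M a k ^ 2)).const_mul (omegaPlus M a k)
    exact this.congr_deriv (by simp)
  have d1 := hasDerivAt_horizonOp h m (contDiffOn_horizonOp h m hvc) hr
  have d2 := (hode r hr).neg.sub ((((hasDerivAt_deriv_Delta M a k r).div hP1 hP0.ne').ofReal_comp.add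
    (((hκ1.const_mul (Xi a k * m)).div hP1 hP0.ne').ofReal_comp.const_mul Complex.I)).mul hA1)
  have e := d1.unique (d2.congr_of_eventuallyEq (by
    filter_upwards [Ioi_mem_nhds hr] with y hy
    rw [horizonOp_eq_flux h hA hy]
    simp))
  have e1 := horizonOp_eq_flux h (m := m) hA hr
  have eκ : (corot M a k r : ℂ) = Delta M a k r * corotRatio M a k r := by
    exact_mod_cast corot_eq h hr.le
  rw [← hv] at e1
  simp only [Function.iterate_succ, Function.iterate_zero, Function.comp, id]
  generalize horizonOp M a k m (horizonOp M a k m v) r = j at *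
  generalize horizonOp M a k m v r = H at *
  simp only [radialPot, staticPot, resPot, resStatic, resRot, Pi.div_apply, Pi.add_apply] at e ⊢
  generalize deriv A r = A' at *
  generalize A r = A0 at *
  generalize deriv (Delta M a k) r = D1 at *
  push_cast at e e1 ⊢
  rw [eκ] at e e1 ⊢
  have hI := Complex.I_sq
  generalize (Delta M a k r : ℂ) = D at *
  generalize (corotRatio M a k r : ℂ) = γ at *
  generalize (omegaPlus M a k : ℂ) = w at *
  generalize (Xi a k : ℂ) = X at *
  generalize Complex.I = J at *
  -- eliminate `A'` through the flux form of `Δ⁻¹ L̲ v`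
  have e2 : A' = -(H + (D1 / (r ^ 2 + a ^ 2) + J * (X * m * (D * γ) / (r ^ 2 + a ^ 2))) * A0)
      * (r ^ 2 + a ^ 2) / D := by
    rw [e1]; field_simp; ring
  have e3 : -((r : ℂ) ^ 2 + a ^ 2) * j = -((r : ℂ) ^ 2 + a ^ 2) * j
    - J * (X * m * γ) * H + J * (X * m * γ) * H := by ring
  rw [e, e2] at e3
  have e4 : -(D * ((r : ℂ) ^ 2 + a ^ 2)) * j = D * (-((r : ℂ) ^ 2 + a ^ 2) * j) := by ring
  rw [e4, e3]
  field_simp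
  ring_nf
  have hJ : J ^ 2 = -1 := hI
  simp only [hJ]
  ring

/-- A function whose value at `r₊` obstructs a solution regular at the horizon with `v ≠ 0` there;
it comes from the regularised equation and its first derivative, see `resonance_mul_eq`. -/
noncomputable def resonance (M a k : ℝ) (m : ℤ) (lam : ℂ) (r : ℝ) : ℂ :=
  resPot M a k m lam r ^ 2
    + resPot M a k m lam r * (((12 * k ^ 2 * r ^ 2 + 2 * (1 + a ^ 2 * k ^ 2)
        + deriv (Delta M a k) r * (2 * r) / (r ^ 2 + a ^ 2) : ℝ) : ℂ)
      + Complex.I * ((m * (4 * Xi a k * omegaPlus M a k * r) : ℝ) : ℂ))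
    - ((deriv (Delta M a k) r * deriv (resStatic M a k) r : ℝ) : ℂ)
    - Complex.I * ((m * (deriv (Delta M a k) r * deriv (resRot M a k) r) : ℝ) : ℂ)

theorem norm_ofReal_add_I_mul_le (x y : ℝ) (m : ℤ) :
    ‖(x : ℂ) + Complex.I * ((m * y : ℝ) : ℂ)‖ ≤ (|x| + |y|) * (1 + |(m : ℝ)|) := by
  have h1 : ‖(x : ℂ)‖ = |x| := Complex.norm_real x
  have h2 : ‖Complex.I * ((m * y : ℝ) : ℂ)‖ = |(m : ℝ)| * |y| := by
    rw [norm_mul, Complex.norm_I, one_mul, Complex.norm_real, Real.norm_eq_abs, abs_mul]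
  refine (norm_add_le _ _).trans ?_
  rw [h1, h2]
  have := abs_nonneg x
  have := abs_nonneg y
  have := abs_nonneg (m : ℝ)
  nlinarith

/-- The resonance is quadratic in the separation constant, with lower coefficients at most linear
in `m`. -/
theorem exists_resonance_ne_zero (M a k : ℝ) :
    ∃ C : ℝ, ∀ (m : ℤ) (lam : ℂ), C * (1 + |(m : ℝ)|) ≤ lam.re →
      resonance M a k m lam (rPlus M a k) ≠ 0 := by
  unfold resonance
  set p := rPlus M a k
  obtain ⟨x₁, hx₁⟩ : ∃ x, x = 12 * k ^ 2 * p ^ 2 + 2 * (1 + a ^ 2 * k ^ 2)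
        + deriv (Delta M a k) p * (2 * p) / (p ^ 2 + a ^ 2) := ⟨_, rfl⟩
  obtain ⟨y₁, hy₁⟩ : ∃ x, x = 4 * Xi a k * omegaPlus M a k * p := ⟨_, rfl⟩
  obtain ⟨x₂, hx₂⟩ : ∃ x, x = deriv (Delta M a k) p * deriv (resStatic M a k) p := ⟨_, rfl⟩
  obtain ⟨y₂, hy₂⟩ : ∃ x, x = deriv (Delta M a k) p * deriv (resRot M a k) p := ⟨_, rfl⟩
  rw [← hx₁, ← hy₁, ← hx₂, ← hy₂]
  refine ⟨|resStatic M a k p| + (|x₁| + |y₁|) + (|x₂| + |y₂|) + 1, fun m lam hlam h0 => ?_⟩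
  set z := resPot M a k m lam p with hz
  have b1 := norm_ofReal_add_I_mul_le x₁ y₁ m
  have b2 := norm_ofReal_add_I_mul_le x₂ y₂ m
  set β := (x₁ : ℂ) + Complex.I * ((m * y₁ : ℝ) : ℂ)
  set γ := (x₂ : ℂ) + Complex.I * ((m * y₂ : ℝ) : ℂ) with hγ
  have hm := abs_nonneg (m : ℝ)
  have n1 : 0 ≤ |x₁| + |y₁| := by positivity
  have n2 : 0 ≤ |x₂| + |y₂| := by positivity
  have n3 := abs_nonneg (resStatic M a k p)
  have hre : ((|x₁| + |y₁|) + (|x₂| + |y₂|) + 1) * (1 + |(m : ℝ)|) ≤ ‖z‖ := by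
    refine le_trans ?_ (Complex.re_le_norm z)
    have e : z.re = lam.re + resStatic M a k p := by
      simp [hz, resPot]
    have := neg_abs_le (resStatic M a k p)
    rw [e]
    nlinarith
  have e : z * (z + β) = γ := by
    rw [hγ]; linear_combination h0
  have e' : ‖z‖ * ‖z + β‖ = ‖γ‖ := by rw [← norm_mul, e]
  have t : ‖z‖ - ‖β‖ ≤ ‖z + β‖ := by
    have := norm_sub_le (z + β) β
    rw [add_sub_cancel_right] at this
    linarith
  have t1 : 1 + (|x₂| + |y₂|) ≤ ‖z + β‖ := by nlinarith
  have t2 : 1 ≤ ‖z‖ := by nlinarith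
  nlinarith

theorem isLittleO_sub_of_tendsto_deriv {f f' : ℝ → ℂ} {p : ℝ}
    (hd : ∀ r, p < r → HasDerivAt f (f' r) r) (hf : Tendsto f (𝓝[>] p) (𝓝 0))
    (hf' : Tendsto f' (𝓝[>] p) (𝓝 0)) : f =o[𝓝[>] p] fun r => r - p := by
  rw [Asymptotics.isLittleO_iff]
  intro c hc
  have h1 : ∀ᶠ r in 𝓝[>] p, ‖f' r‖ ≤ c := by
    have := hf'.norm
    rw [norm_zero] at this
    exact (this.eventually_lt_const hc).mono fun _ h => h.le
  obtain ⟨u, hu, hsub⟩ := mem_nhdsGT_iff_exists_Ioo_subset.1 h1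
  filter_upwards [Ioo_mem_nhdsGT hu] with r hr
  have hlim : Tendsto (fun s => ‖f r - f s‖) (𝓝[>] p) (𝓝 ‖f r - 0‖) :=
    (tendsto_const_nhds.sub hf).norm
  have hlim2 : Tendsto (fun s => c * ‖r - s‖) (𝓝[>] p) (𝓝 (c * ‖r - p‖)) :=
    ((by fun_prop : Continuous fun s : ℝ => c * ‖r - s‖).tendsto p).mono_left nhdsWithin_le_nhds
  rw [sub_zero] at hlim
  refine le_of_tendsto_of_tendsto hlim hlim2 ?_
  filter_upwards [Ioo_mem_nhdsGT hr.1] with s hs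
  exact (convex_Ioo p u).norm_image_sub_le_of_norm_hasDerivWithin_le
    (fun x hx => (hd x hx.1).hasDerivWithinAt) (fun x hx => hsub hx) ⟨hs.1, hs.2.trans hr.2⟩ hr

theorem contDiffOn_resStatic {M a k : ℝ} : ContDiffOn ℝ ∞ (resStatic M a k) (Ioi 0) := by
  have hP : ∀ r ∈ Ioi (0 : ℝ), r ^ 2 + a ^ 2 ≠ 0 := fun r (hr : 0 < r) => by positivity
  have hP2 : ∀ r ∈ Ioi (0 : ℝ), (r ^ 2 + a ^ 2) ^ 2 ≠ 0 := fun r hr => pow_ne_zero _ (hP r hr)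
  have hPc : ContDiffOn ℝ ∞ (fun r : ℝ => r ^ 2 + a ^ 2) (Ioi 0) := by fun_prop
  have hDc := (contDiff_Delta M a k).contDiffOn (s := Ioi 0)
  have hD' : ContDiffOn ℝ ∞ (deriv (Delta M a k)) (Ioi 0) := by rw [deriv_Delta]; fun_prop
  unfold resStatic
  refine (((hDc.div hPc hP).sub ((contDiffOn_id.mul hD').div hPc hP)).sub
    (ContDiffOn.div (ContDiffOn.mul ?_ hDc) (hPc.pow 2) hP2)).sub ?_ <;> fun_prop

theorem contDiffOn_resRot {M a k : ℝ} : ContDiffOn ℝ ∞ (resRot M a k) (Ioi 0) := by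
  have hP : ∀ r ∈ Ioi (0 : ℝ), r ^ 2 + a ^ 2 ≠ 0 := fun r (hr : 0 < r) => by positivity
  unfold resRot corot
  refine ContDiffOn.sub ?_ (ContDiffOn.div ?_ ?_ hP) <;> fun_prop

theorem hasDerivAt_resPot {M a k : ℝ} (m : ℤ) (lam : ℂ) {r : ℝ} (hr : 0 < r) :
    HasDerivAt (resPot M a k m lam) (((deriv (resStatic M a k) r : ℝ) : ℂ)
      + Complex.I * ((m * deriv (resRot M a k) r : ℝ) : ℂ)) r := by
  have h1 := ((contDiffOn_resStatic (M := M) (a := a) (k := k)).differentiableOn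
    (by simp)).differentiableAt (isOpen_Ioi.mem_nhds hr) |>.hasDerivAt
  have h2 := ((contDiffOn_resRot (M := M) (a := a) (k := k)).differentiableOn
    (by simp)).differentiableAt (isOpen_Ioi.mem_nhds hr) |>.hasDerivAt
  exact ((h1.ofReal_comp.const_add lam).add
    ((h2.const_mul (m : ℝ)).ofReal_comp.const_mul Complex.I))

theorem continuousAt_resonance {M a k : ℝ} (m : ℤ) (lam : ℂ) {r : ℝ} (hr : 0 < r) :
    ContinuousAt (resonance M a k m lam) r := by
  have h1 := (((contDiffOn_infty_iff_deriv_of_isOpen isOpen_Ioi).1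
    (contDiffOn_resStatic (M := M) (a := a) (k := k))).2.continuousOn).continuousAt
    (isOpen_Ioi.mem_nhds hr)
  have h2 := (((contDiffOn_infty_iff_deriv_of_isOpen isOpen_Ioi).1
    (contDiffOn_resRot (M := M) (a := a) (k := k))).2.continuousOn).continuousAt
    (isOpen_Ioi.mem_nhds hr)
  have h3 := (hasDerivAt_resPot (M := M) (a := a) (k := k) m lam hr).continuousAt
  have h4 := (hasDerivAt_deriv_Delta M a k r).continuousAt
  have h5 : r ^ 2 + a ^ 2 ≠ 0 := by positivity
  have h6 : ContinuousAt (fun r => deriv (Delta M a k) r * (2 * r) / (r ^ 2 + a ^ 2)) r :=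
    ContinuousAt.div (by fun_prop) (by fun_prop) h5
  unfold resonance
  fun_prop

/-- The factor in front of `h` in the differentiated equation. -/
noncomputable def resFactor (M a k : ℝ) (m : ℤ) (lam : ℂ) (r : ℝ) : ℂ :=
  ((12 * k ^ 2 * r ^ 2 + 2 * (1 + a ^ 2 * k ^ 2) : ℝ) : ℂ)
    + Complex.I * ((Xi a k * m * (4 * omegaPlus M a k * r
      - deriv (Delta M a k) r * corotRatio M a k r) : ℝ) : ℂ) + resPot M a k m lam r

/-- Eliminating `h` between the regularised equation and its derivative leaves a multiple of `v`,
equal to `Δ` times quantities that are bounded at the horizon. -/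
theorem resonance_mul_eq {M a k : ℝ} (h : Admissible M a k) {m : ℤ} {lam : ℂ} {V : ℕ → ℝ → ℂ}
    (hV : ∀ q r, rPlus M a k < r → HasDerivAt (V q) (-((r ^ 2 + a ^ 2 : ℝ) : ℂ) * V (q + 1) r
      - Complex.I * ((Xi a k * m * corotRatio M a k r : ℝ) : ℂ) * V q r) r)
    (hrel : ∀ r, rPlus M a k < r → -((Delta M a k r * (r ^ 2 + a ^ 2) : ℝ) : ℂ) * V 2 r
      = (((deriv (Delta M a k) r : ℝ) : ℂ)
          + Complex.I * ((2 * Xi a k * m * corot M a k r : ℝ) : ℂ)) * V 1 r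
        - resPot M a k m lam r / ((r ^ 2 + a ^ 2 : ℝ) : ℂ) * V 0 r)
    {r : ℝ} (hr : rPlus M a k < r) :
    resonance M a k m lam r * V 0 r = (Delta M a k r : ℂ) * (((r ^ 2 + a ^ 2 : ℝ) : ℂ)
      * (((deriv (Delta M a k) r : ℝ) : ℂ) * (((r ^ 2 + a ^ 2 : ℝ) : ℂ) ^ 2 * V 3 r
          + (3 * Complex.I * ((Xi a k * m * corotRatio M a k r * (r ^ 2 + a ^ 2) : ℝ) : ℂ)
            - ((2 * r : ℝ) : ℂ)) * V 2 r
          - 2 * ((Xi a k * m * corotRatio M a k r : ℝ) : ℂ) ^ 2 * V 1 r)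
        + resFactor M a k m lam r * (((r ^ 2 + a ^ 2 : ℝ) : ℂ) * V 2 r
          + 2 * Complex.I * ((Xi a k * m * corotRatio M a k r : ℝ) : ℂ) * V 1 r))) := by
  have hr0 : 0 < r := h.rPlus_pos.trans hr
  have hP0 : 0 < r ^ 2 + a ^ 2 := by positivity
  have hP : (r : ℂ) ^ 2 + (a : ℂ) ^ 2 ≠ 0 := by exact_mod_cast hP0.ne'
  have hPc : ((r ^ 2 + a ^ 2 : ℝ) : ℂ) ≠ 0 := by exact_mod_cast hP0.ne'
  have hP1 : HasDerivAt (fun r : ℝ => r ^ 2 + a ^ 2) (2 * r) r :=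
    (((hasDerivAt_id r).pow 2).add_const (a ^ 2)).congr_deriv (by simp)
  have hκ1 : HasDerivAt (corot M a k) (omegaPlus M a k * (2 * r)) r := by
    have := (((hasDerivAt_id r).pow 2).sub_const (rPlus M a k ^ 2)).const_mul (omegaPlus M a k)
    exact this.congr_deriv (by simp)
  have hD1 := hasDerivAt_Delta M a k r
  have d1 := ((hD1.mul hP1).ofReal_comp.neg).mul (hV 2 r hr)
  have d2 := (((hasDerivAt_deriv_Delta M a k r).ofReal_comp.add
      ((hκ1.const_mul (2 * Xi a k * m)).ofReal_comp.const_mul Complex.I)).mul (hV 1 r hr)).sub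
    (((hasDerivAt_resPot (M := M) (a := a) (k := k) m lam hr0).div hP1.ofReal_comp hPc).mul
      (hV 0 r hr))
  have e := d1.unique (d2.congr_of_eventuallyEq (by
    filter_upwards [Ioi_mem_nhds hr] with y hy using hrel y hy))
  have e0 := hrel r hr
  have eκ : (corot M a k r : ℂ) = Delta M a k r * corotRatio M a k r := by
    exact_mod_cast corot_eq h hr.le
  simp only [Pi.mul_apply, Pi.add_apply, Pi.div_apply, Pi.neg_apply] at e
  unfold resonance resFactor
  generalize V 3 r = V3 at *
  generalize V 2 r = V2 at *
  generalize V 1 r = V1 at *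
  generalize V 0 r = V0 at *
  generalize deriv (resStatic M a k) r = s' at *
  generalize deriv (resRot M a k) r = q' at *
  generalize resPot M a k m lam r = z at *
  generalize deriv (Delta M a k) r = D1 at *
  push_cast at e e0 ⊢
  rw [eκ] at e e0
  generalize (corotRatio M a k r : ℂ) = γ at *
  generalize (omegaPlus M a k : ℂ) = w at *
  generalize (Xi a k : ℂ) = X at *
  have hI := Complex.I_sq
  generalize Complex.I = J at *
  generalize (Delta M a k r : ℂ) = D at *
  have hJ : J ^ 2 = -1 := hI
  generalize (r : ℂ) = ρ at *
  field_simp at e e0 ⊢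
  linear_combination (-(D1 : ℂ)) * e
    + (ρ ^ 2 + (a : ℂ) ^ 2) * (12 * k ^ 2 * ρ ^ 2 + 2 * (1 + a ^ 2 * k ^ 2)
      + J * (X * m * (4 * w * ρ - D1 * γ)) + z) * e0
    + 2 * (ρ ^ 2 + (a : ℂ) ^ 2) ^ 2 * D * D1 * X ^ 2 * m ^ 2 * γ ^ 2 * V1 * hJ

/-- For spin `+2`, absent resonance, regularity at all orders forces the profile to vanish at the
horizon. -/
theorem tendsto_flux_of_spin_pos {M a k : ℝ} (h : Admissible M a k) {m : ℤ} {A : ℝ → ℂ} {lam : ℂ}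
    (hA : ContDiffOn ℝ ∞ A (Ioi (rPlus M a k)))
    (hode : ∀ r, rPlus M a k < r →
      HasDerivAt (fun r => ((Delta M a k r / (r ^ 2 + a ^ 2) : ℝ) : ℂ) * deriv A r)
        (radialPot M a k m lam r / ((r ^ 2 + a ^ 2 : ℝ) : ℂ) * A r) r)
    (hb : ∀ q : ℕ, (horizonOp M a k m)^[q] (fun r => (Delta M a k r : ℂ) * A r)
      =O[𝓝[>] rPlus M a k] (fun _ => (1 : ℝ)))
    (hres : resonance M a k m lam (rPlus M a k) ≠ 0) :
    Tendsto (fun r => ((Delta M a k r / (r ^ 2 + a ^ 2) : ℝ) : ℂ) * deriv A r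
      * (starRingEnd ℂ) (A r)) (𝓝[>] rPlus M a k) (𝓝 0) := by
  have hp := h.rPlus_pos
  set V : ℕ → ℝ → ℂ := fun q => (horizonOp M a k m)^[q] (fun r => (Delta M a k r : ℂ) * A r)
    with hVdef
  have hVs : ∀ q, V (q + 1) = horizonOp M a k m (V q) := fun q =>
    Function.iterate_succ_apply' _ _ _
  have hVc : ∀ q, ContDiffOn ℝ ∞ (V q) (Ioi (rPlus M a k)) := by
    intro q
    induction q with
    | zero => exact (Complex.ofRealCLM.contDiff.comp (contDiff_Delta M a k)).contDiffOn.mul hA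
    | succ q ih => rw [hVs]; exact contDiffOn_horizonOp h m ih
  have hV : ∀ q r, rPlus M a k < r → HasDerivAt (V q) (-((r ^ 2 + a ^ 2 : ℝ) : ℂ) * V (q + 1) r
      - Complex.I * ((Xi a k * m * corotRatio M a k r : ℝ) : ℂ) * V q r) r := by
    intro q r hr
    rw [hVs]
    exact hasDerivAt_horizonOp h m (hVc q) hr
  have hrel : ∀ r, rPlus M a k < r → -((Delta M a k r * (r ^ 2 + a ^ 2) : ℝ) : ℂ) * V 2 r
      = (((deriv (Delta M a k) r : ℝ) : ℂ)
          + Complex.I * ((2 * Xi a k * m * corot M a k r : ℝ) : ℂ)) * V 1 r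
        - resPot M a k m lam r / ((r ^ 2 + a ^ 2 : ℝ) : ℂ) * V 0 r :=
    fun r hr => spin_pos_relation h hA hode hr
  have hself : Ioi (rPlus M a k) ∈ 𝓝[>] rPlus M a k := self_mem_nhdsWithin
  have hD'c : ContinuousAt (deriv (Delta M a k)) (rPlus M a k) :=
    (hasDerivAt_deriv_Delta M a k _).continuousAt
  have hzc : ContinuousAt (resPot M a k m lam) (rPlus M a k) :=
    (hasDerivAt_resPot m lam hp).continuousAt
  have hγc := continuousAt_corotRatio h
  have hFc : ContinuousAt (resFactor M a k m lam) (rPlus M a k) := by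
    unfold resFactor; fun_prop
  have hDlim : Tendsto (fun r => (Delta M a k r : ℂ)) (𝓝[>] rPlus M a k) (𝓝 0) := by
    have := (Complex.continuous_ofReal.tendsto 0).comp (tendsto_Delta_rPlus h)
    simpa [Function.comp_def] using this
  have hbd : ∀ {F : ℝ → ℂ}, ContinuousAt F (rPlus M a k) →
      F =O[𝓝[>] rPlus M a k] (fun _ => (1 : ℝ)) := fun hF =>
    (hF.tendsto.mono_left nhdsWithin_le_nhds).isBigO_one ℝ
  have hmul : ∀ {F G : ℝ → ℂ}, F =O[𝓝[>] rPlus M a k] (fun _ => (1 : ℝ)) →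
      G =O[𝓝[>] rPlus M a k] (fun _ => (1 : ℝ)) →
      (fun r => F r * G r) =O[𝓝[>] rPlus M a k] (fun _ => (1 : ℝ)) := fun hF hG => by
    simpa only [mul_one] using hF.mul hG
  -- `v → 0`
  have hV0 : Tendsto (V 0) (𝓝[>] rPlus M a k) (𝓝 0) := by
    have hB := hmul (hbd (F := fun r => ((r ^ 2 + a ^ 2 : ℝ) : ℂ)) (by fun_prop))
      ((hmul (hbd (F := fun r => ((deriv (Delta M a k) r : ℝ) : ℂ)) (by fun_prop))
        (((hmul (hbd (F := fun r => ((r ^ 2 + a ^ 2 : ℝ) : ℂ) ^ 2) (by fun_prop)) (hb 3)).add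
          (hmul (hbd (F := fun r => (3 * Complex.I * ((Xi a k * m * corotRatio M a k r
            * (r ^ 2 + a ^ 2) : ℝ) : ℂ) - ((2 * r : ℝ) : ℂ))) (by fun_prop)) (hb 2))).sub
          (hmul (hbd (F := fun r => 2 * ((Xi a k * m * corotRatio M a k r : ℝ) : ℂ) ^ 2)
            (by fun_prop)) (hb 1)))).add
        (hmul (hbd hFc)
          ((hmul (hbd (F := fun r => ((r ^ 2 + a ^ 2 : ℝ) : ℂ)) (by fun_prop)) (hb 2)).add
          (hmul (hbd (F := fun r => 2 * Complex.I * ((Xi a k * m * corotRatio M a k r : ℝ) : ℂ))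
            (by fun_prop)) (hb 1)))))
    have h1 := tendsto_zero_of_mul_isBigO_one hDlim hB
    have hc := (continuousAt_resonance (M := M) (a := a) (k := k) m lam hp)
    have h2 : Tendsto (fun r => (resonance M a k m lam r)⁻¹) (𝓝[>] rPlus M a k)
        (𝓝 (resonance M a k m lam (rPlus M a k))⁻¹) :=
      (hc.inv₀ hres).tendsto.mono_left nhdsWithin_le_nhds
    have h3 := h2.mul h1
    rw [mul_zero] at h3
    refine h3.congr' ?_
    have h4 : ∀ᶠ r in 𝓝[>] rPlus M a k, resonance M a k m lam r ≠ 0 :=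
      nhdsWithin_le_nhds (hc.eventually_ne hres)
    filter_upwards [hself, h4] with r hr hr4
    rw [← resonance_mul_eq h hV hrel hr, inv_mul_cancel_left₀ hr4]
  -- `h → 0`, because `Δ' h - z v / (r² + a²) → 0` and `Δ'(r₊) ≠ 0`
  have hD'0 : deriv (Delta M a k) (rPlus M a k) ≠ 0 := by
    have hs : HasDerivAt (Delta M a k) (slope M a k (rPlus M a k)) (rPlus M a k) := by
      have h1 := ((hasDerivAt_id (rPlus M a k)).sub_const (rPlus M a k)).mul
        (((contDiff_slope M a k).differentiable (by simp) (rPlus M a k)).hasDerivAt)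
      have h2 : Delta M a k = (fun r => (r - rPlus M a k) * slope M a k r) :=
        funext h.Delta_eq
      rw [h2]
      exact h1.congr_deriv (by simp)
    rw [hs.deriv]
    exact h.slope_rPlus_pos.ne'
  have hP0 : rPlus M a k ^ 2 + a ^ 2 ≠ 0 := by positivity
  have hPc0 : ((rPlus M a k ^ 2 + a ^ 2 : ℝ) : ℂ) ≠ 0 := by exact_mod_cast hP0
  have hV1 : Tendsto (V 1) (𝓝[>] rPlus M a k) (𝓝 0) := by
    have t1 := tendsto_zero_of_mul_isBigO_one hDlim
      (hmul (hbd (F := fun r => ((r ^ 2 + a ^ 2 : ℝ) : ℂ)) (by fun_prop)) (hb 2))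
    have t2 := tendsto_zero_of_mul_isBigO_one hDlim
      (hmul (hbd (F := fun r => 2 * Complex.I * ((Xi a k * m * corotRatio M a k r : ℝ) : ℂ))
        (by fun_prop)) (hb 1))
    have t3 := tendsto_zero_of_mul_isBigO_one hV0 (hbd (F := fun r =>
      resPot M a k m lam r / ((r ^ 2 + a ^ 2 : ℝ) : ℂ))
      (ContinuousAt.div hzc (by fun_prop) hPc0))
    have hc : ContinuousAt (fun r => ((deriv (Delta M a k) r : ℝ) : ℂ)) (rPlus M a k) := by
      fun_prop
    have hc0 : ((deriv (Delta M a k) (rPlus M a k) : ℝ) : ℂ) ≠ 0 := by exact_mod_cast hD'0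
    have h2 : Tendsto (fun r => (((deriv (Delta M a k) r : ℝ) : ℂ))⁻¹) (𝓝[>] rPlus M a k)
        (𝓝 (((deriv (Delta M a k) (rPlus M a k) : ℝ) : ℂ))⁻¹) :=
      (hc.inv₀ hc0).tendsto.mono_left nhdsWithin_le_nhds
    have h3 := h2.mul ((t3.sub t1).sub t2)
    rw [sub_zero, sub_zero, mul_zero] at h3
    refine h3.congr' ?_
    have h4 : ∀ᶠ r in 𝓝[>] rPlus M a k, ((deriv (Delta M a k) r : ℝ) : ℂ) ≠ 0 :=
      nhdsWithin_le_nhds (hc.eventually_ne hc0)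
    filter_upwards [hself, h4] with r hr hr4
    have e := hrel r hr
    rw [corot_eq h (le_of_lt hr)] at e
    rw [inv_mul_eq_iff_eq_mul₀ hr4]
    push_cast at e ⊢
    linear_combination e
  -- hence `v' → 0` and `v = o(r - r₊)`, so that `A = v / Δ → 0`
  have hA0 : Tendsto A (𝓝[>] rPlus M a k) (𝓝 0) := by
    have t1 := tendsto_zero_of_mul_isBigO_one hV1
      (hbd (F := fun r => -((r ^ 2 + a ^ 2 : ℝ) : ℂ)) (by fun_prop))
    have t2 := tendsto_zero_of_mul_isBigO_one hV0 (hbd (F := fun r =>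
      Complex.I * ((Xi a k * m * corotRatio M a k r : ℝ) : ℂ)) (by fun_prop))
    have h1 := isLittleO_sub_of_tendsto_deriv (fun r hr => hV 0 r hr) hV0 (by
      have := t1.sub t2
      rw [sub_zero] at this
      exact this.congr fun r => by ring)
    have h2 := Asymptotics.IsLittleO.tendsto_inv_smul_nhds_zero h1
    have hs0 : ((slope M a k (rPlus M a k) : ℝ) : ℂ) ≠ 0 := by
      exact_mod_cast h.slope_rPlus_pos.ne'
    have hsc : ContinuousAt (fun r => ((slope M a k r : ℝ) : ℂ)) (rPlus M a k) := by
      have := continuous_slope M a k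
      fun_prop
    have h3 := tendsto_zero_of_mul_isBigO_one h2 (hbd (hsc.inv₀ hs0))
    refine h3.congr' ?_
    filter_upwards [hself] with r hr
    have e1 : ((r - rPlus M a k : ℝ) : ℂ) ≠ 0 := by
      exact_mod_cast (sub_pos.2 hr).ne'
    have e2 : ((slope M a k r : ℝ) : ℂ) ≠ 0 := by
      exact_mod_cast (h.slope_pos (le_of_lt hr)).ne'
    have e3 : V 0 r = (((r - rPlus M a k) * slope M a k r : ℝ) : ℂ) * A r := by
      rw [← h.Delta_eq]; rfl
    rw [e3, Complex.real_smul]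
    push_cast [Pi.inv_apply] at e1 e2 ⊢
    field_simp
  have hA1 : Tendsto (fun r => ((Delta M a k r / (r ^ 2 + a ^ 2) : ℝ) : ℂ) * deriv A r)
      (𝓝[>] rPlus M a k) (𝓝 0) := by
    have hκc : ContinuousAt (fun r => (((deriv (Delta M a k) r / (r ^ 2 + a ^ 2) : ℝ) : ℂ)
          + Complex.I * ((Xi a k * m * corot M a k r / (r ^ 2 + a ^ 2) : ℝ) : ℂ)))
        (rPlus M a k) := by
      have h1 : ContinuousAt (fun r => deriv (Delta M a k) r / (r ^ 2 + a ^ 2)) (rPlus M a k) :=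
        hD'c.div (by fun_prop) hP0
      have h2 : ContinuousAt (fun r => Xi a k * m * corot M a k r / (r ^ 2 + a ^ 2))
          (rPlus M a k) := ContinuousAt.div (by unfold corot; fun_prop) (by fun_prop) hP0
      fun_prop
    have t1 := tendsto_zero_of_mul_isBigO_one hA0 (hbd hκc)
    have t2 := hV1.neg.sub t1
    rw [neg_zero, sub_zero] at t2
    refine t2.congr' ?_
    filter_upwards [hself] with r hr
    have e : V 1 r = _ := horizonOp_eq_flux h hA hr
    rw [e]
    ring
  have hAc : Tendsto (fun r => (starRingEnd ℂ) (A r)) (𝓝[>] rPlus M a k) (𝓝 0) := by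
    have := (Complex.continuous_conj.tendsto 0).comp hA0
    simpa [Function.comp_def] using this
  simpa using hA1.mul hAc

/-! ### The energy flux -/

/-- A radial profile `A` with `r⋆`-derivative `A₁`, solving a radial equation with potential of
positive real part, with no flux through the horizon and finite boundary values at infinity. -/
structure IsRadialProfile (M a k : ℝ) (A A₁ : ℝ → ℂ) : Prop where
  exists_pot : ∃ W : ℝ → ℂ, ∀ r, rPlus M a k < r → 0 < (W r).re ∧
    HasDerivAt A ((((r ^ 2 + a ^ 2) / Delta M a k r : ℝ) : ℂ) * A₁ r) r ∧
    HasDerivAt A₁ (W r / ((r ^ 2 + a ^ 2 : ℝ) : ℂ) * A r) r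
  horizon : Tendsto (fun r => A₁ r * (starRingEnd ℂ) (A r)) (𝓝[>] rPlus M a k) (𝓝 0)
  infinity : ∃ L, Tendsto A atTop (𝓝 L)
  infinity_deriv : ∃ L, Tendsto A₁ atTop (𝓝 L)

theorem isRadialProfile_of_eq_zero {M a k : ℝ} {A A₁ : ℝ → ℂ}
    (hA : ∀ r, rPlus M a k < r → A r = 0) (hA₁ : ∀ r, rPlus M a k < r → A₁ r = 0) :
    IsRadialProfile M a k A A₁ := by
  have hd : ∀ {F : ℝ → ℂ}, (∀ r, rPlus M a k < r → F r = 0) → ∀ r, rPlus M a k < r →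
      HasDerivAt F 0 r := fun hF r hr =>
    (hasDerivAt_const r (0 : ℂ)).congr_of_eventuallyEq
      (by filter_upwards [Ioi_mem_nhds hr] with y hy using hF y hy)
  have ht : ∀ {F : ℝ → ℂ}, (∀ r, rPlus M a k < r → F r = 0) → Tendsto F atTop (𝓝 0) :=
    fun hF => tendsto_const_nhds.congr'
      (by filter_upwards [Ioi_mem_atTop (rPlus M a k)] with y hy using (hF y hy).symm)
  refine ⟨⟨1, fun r hr => ⟨by simp, ?_, ?_⟩⟩, ?_, ⟨0, ht hA⟩, ⟨0, ht hA₁⟩⟩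
  · rw [hA₁ r hr, mul_zero]; exact hd hA r hr
  · rw [hA r hr, mul_zero]; exact hd hA₁ r hr
  · refine tendsto_const_nhds.congr' ?_
    filter_upwards [self_mem_nhdsWithin] with r hr
    rw [hA r hr, hA₁ r hr, zero_mul]

theorem IsRadialProfile.mul_const {M a k : ℝ} {A A₁ : ℝ → ℂ} (H : IsRadialProfile M a k A A₁)
    (c : ℂ) : IsRadialProfile M a k (fun r => A r * c) (fun r => A₁ r * c) := by
  obtain ⟨⟨W, hW⟩, hor, ⟨L, hL⟩, ⟨L₁, hL₁⟩⟩ := H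
  refine ⟨⟨W, fun r hr => ?_⟩, ?_, ⟨_, hL.mul_const c⟩, ⟨_, hL₁.mul_const c⟩⟩
  · obtain ⟨h1, h2, h3⟩ := hW r hr
    exact ⟨h1, (h2.mul_const c).congr_deriv (by ring), (h3.mul_const c).congr_deriv (by ring)⟩
  · have := hor.mul_const (c * (starRingEnd ℂ) c)
    rw [zero_mul] at this
    refine this.congr fun r => ?_
    rw [map_mul]; ring

/-- Two radial profiles coupled by the conformal boundary conditions vanish: the sum of their
fluxes is increasing, and vanishes both at the horizon and at infinity. -/
theorem IsRadialProfile.eq_zero {M a k : ℝ} (h : Admissible M a k) {A A₁ B B₁ : ℝ → ℂ}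
    (HA : IsRadialProfile M a k A A₁) (HB : IsRadialProfile M a k B B₁)
    (hbc : Tendsto (fun r => A r - (starRingEnd ℂ) (B r)) atTop (𝓝 0))
    (hbc₁ : Tendsto (fun r => A₁ r + (starRingEnd ℂ) (B₁ r)) atTop (𝓝 0)) :
    ∀ r, rPlus M a k < r → A r = 0 ∧ B r = 0 := by
  have hflux : ∀ {A A₁ : ℝ → ℂ}, IsRadialProfile M a k A A₁ → ∃ G : ℝ → ℝ,
      ∀ r ∈ Ioi (rPlus M a k), HasDerivAt (fun r => (A₁ r * (starRingEnd ℂ) (A r)).re) (G r) r ∧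
        0 ≤ G r ∧ (G r = 0 → A r = 0) := by
    intro A A₁ H
    obtain ⟨W, hW⟩ := H.exists_pot
    refine ⟨fun r => (W r).re / (r ^ 2 + a ^ 2) * ‖A r‖ ^ 2
      + (r ^ 2 + a ^ 2) / Delta M a k r * ‖A₁ r‖ ^ 2, fun r hr => ?_⟩
    obtain ⟨h1, h2, h3⟩ := hW r hr
    have hD := h.Delta_pos hr
    have hP : 0 < r ^ 2 + a ^ 2 := by
      have : 0 < r := h.rPlus_pos.trans hr
      positivity
    refine ⟨?_, by positivity, fun h0 => ?_⟩
    · refine (hasDerivAt_re_mul_conj h3 h2).congr_deriv ?_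
      beta_reduce
      rw [map_mul, Complex.conj_ofReal, mul_assoc _ (A r), mul_left_comm (A₁ r),
        Complex.mul_conj, Complex.mul_conj, ← Complex.normSq_eq_norm_sq,
        ← Complex.normSq_eq_norm_sq, Complex.re_mul_ofReal, Complex.div_ofReal_re,
        ← Complex.ofReal_mul, Complex.ofReal_re]
    · have h4 : 0 ≤ (r ^ 2 + a ^ 2) / Delta M a k r * ‖A₁ r‖ ^ 2 := by positivity
      by_contra hne
      have : 0 < ‖A r‖ := norm_pos_iff.2 hne
      have : 0 < (W r).re / (r ^ 2 + a ^ 2) * ‖A r‖ ^ 2 := by positivity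
      linarith
  obtain ⟨G, hG⟩ := hflux HA
  obtain ⟨G', hG'⟩ := hflux HB
  have hre : ∀ {F : ℝ → ℂ} {l : Filter ℝ}, Tendsto F l (𝓝 0) →
      Tendsto (fun r => (F r).re) l (𝓝 0) := fun hF => by
    simpa [Function.comp_def] using (Complex.continuous_re.tendsto 0).comp hF
  have hhor := (hre HA.horizon).add (hre HB.horizon)
  rw [add_zero] at hhor
  -- `Re (A₁ Ā) + Re (B₁ B̄) = Re ((A₁ + B̄₁) Ā) - Re (B̄₁ (A - B̄)‾)`
  have hinf : Tendsto (fun r => (A₁ r * (starRingEnd ℂ) (A r)).re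
      + (B₁ r * (starRingEnd ℂ) (B r)).re) atTop (𝓝 0) := by
    obtain ⟨L, hL⟩ := HA.infinity
    obtain ⟨L', hL'⟩ := HB.infinity_deriv
    have c1 := (Complex.continuous_conj.tendsto _).comp hL
    have c2 := (Complex.continuous_conj.tendsto _).comp hL'
    have c3 := (Complex.continuous_conj.tendsto _).comp hbc
    have u1 : Tendsto (fun r => (A₁ r + (starRingEnd ℂ) (B₁ r)) * (starRingEnd ℂ) (A r)) atTop
        (𝓝 0) := by simpa using hbc₁.mul c1
    have u2 : Tendsto (fun r => (starRingEnd ℂ) (B₁ r)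
        * (starRingEnd ℂ) (A r - (starRingEnd ℂ) (B r))) atTop (𝓝 0) := by
      simpa using c2.mul c3
    have t := (hre u1).sub (hre u2)
    rw [sub_zero] at t
    refine t.congr fun r => ?_
    simp only [map_sub, Complex.conj_conj, Complex.mul_re, Complex.sub_re,
      Complex.sub_im, Complex.add_re, Complex.add_im, Complex.conj_re, Complex.conj_im]
    ring
  have hz := deriv_eq_zero_of_tendsto_zero isOpen_Ioi (convex_Ioi (rPlus M a k))
    (fun r hr => (hG r hr).1.add (hG' r hr).1)
    (fun r hr => add_nonneg (hG r hr).2.1 (hG' r hr).2.1)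
    (l₁ := 𝓝[>] rPlus M a k) (l₂ := atTop)
    (fun x hx => by
      filter_upwards [Ioo_mem_nhdsGT hx] with y hy
      exact ⟨hy.1, hy.2.le⟩)
    (fun x hx => by
      filter_upwards [Ici_mem_atTop x] with y hy
      exact ⟨mem_Ioi.2 (lt_of_lt_of_le hx hy), hy⟩)
    hhor hinf
  intro r hr
  have e := hz r hr
  have p1 := (hG r hr).2.1
  have p2 := (hG' r hr).2.1
  exact ⟨(hG r hr).2.2 (by linarith), (hG' r hr).2.2 (by linarith)⟩

/-! ### Modes of large azimuthal number -/

theorem exists_quadratic_pos {α : ℝ} (hα : 0 < α) (β γ : ℝ) :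
    ∃ N : ℝ, ∀ x, N ≤ x → 0 < α * x ^ 2 - β * x - γ := by
  refine ⟨(|β| + |γ|) / α + 1, fun x hx => ?_⟩
  have h0 : 0 ≤ (|β| + |γ|) / α := by positivity
  have h1 : 1 ≤ x := by linarith
  have h2 : |β| + |γ| < α * x := by
    have : (|β| + |γ|) / α < x := by linarith
    rw [div_lt_iff₀ hα] at this
    linarith
  have h3 := le_abs_self β
  have h4 := le_abs_self γ
  have h5 := abs_nonneg γ
  nlinarith

theorem radialPot_re (M a k : ℝ) (m : ℤ) (lam : ℂ) (r : ℝ) :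
    (radialPot M a k m lam r).re = lam.re + (staticPot M a k r
      - Xi a k ^ 2 * m ^ 2 * corot M a k r ^ 2 / Delta M a k r) := by
  unfold radialPot
  rw [Complex.add_re, Complex.add_re, Complex.ofReal_re, Complex.re_mul_ofReal, Complex.I_re,
    zero_mul, add_zero]

/-- For large azimuthal number each component of a regular mode gives a radial profile: the angular
eigenvalue grows like `m²` with a constant larger than that of the rotational term. -/
theorem exists_isRadialProfile {M a k : ℝ} (h : Admissible M a k) (hHR : HawkingReall M a k) :
    ∃ m₀ : ℕ, ∀ (σ s m : ℤ) (R S : ℝ → ℂ) (f : Field), σ = 1 ∨ σ = -1 → (m₀ : ℤ) ≤ |m| →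
      ExtEq M a k f (modeField M a k (σ * m) R S) → RegularUpToInfinity M a k s f →
      SolvesTeukolsky M a k σ f → RegularAtHorizon M a k σ f →
      ∀ θ, 0 < θ → θ < Real.pi → IsRadialProfile M a k (fun r => R r * S θ)
        (fun r => ((Delta M a k r / (r ^ 2 + a ^ 2) : ℝ) : ℂ) * deriv R r * S θ) := by
  obtain ⟨C, q₀, hC⟩ := exists_angPot_ge h
  obtain ⟨C₂, hC₂⟩ := exists_staticPot_ge h
  obtain ⟨C₃, hC₃⟩ := exists_resonance_ne_zero M a k
  obtain ⟨N₁, hN₁⟩ := exists_quadratic_pos (angFloor_pos h) (C + C₃) C₃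
  obtain ⟨N₂, hN₂⟩ := exists_quadratic_pos (sub_pos.2 (hHR.lt_angFloor h)) C C₂
  obtain ⟨m₀, hm₀⟩ := exists_nat_ge (max q₀ (max N₁ N₂))
  refine ⟨m₀, fun σ s m R S f hσ hm hf hinf hT hhor θ h0 hpi => ?_⟩
  by_cases hS : S θ = 0
  · exact isRadialProfile_of_eq_zero (fun r _ => by rw [hS, mul_zero])
      (fun r _ => by rw [hS, mul_zero])
  by_cases hR : ∀ r, rPlus M a k < r → R r = 0
  · refine isRadialProfile_of_eq_zero (fun r hr => by rw [hR r hr, zero_mul]) (fun r hr => ?_)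
    have : deriv R r = 0 := by
      have he : R =ᶠ[𝓝 r] fun _ => 0 := by
        filter_upwards [Ioi_mem_nhds hr] with y hy using hR y hy
      rw [he.deriv_eq, deriv_const]
    rw [this, mul_zero, zero_mul]
  push Not at hR
  obtain ⟨r₀, hr₀, hR₀⟩ := hR
  obtain ⟨hRc, hRlim, hRlim'⟩ := hinf.radial h hHR hf h0 hpi hS
  obtain ⟨hSc, ⟨b1, b2⟩, b3, b4⟩ := hinf.angular h hf hr₀ hR₀
  have hunf : ExtEq M a k (unrenormalise M a k σ f) (modeField M a k (σ * m)
      (fun r => ((Delta M a k r ^ (-σ) * (Real.sqrt (r ^ 2 + a ^ 2))⁻¹ : ℝ) : ℂ) * R r) S) := by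
    rw [← mul_modeField_radial (c := fun r =>
      ((Delta M a k r ^ (-σ) * (Real.sqrt (r ^ 2 + a ^ 2))⁻¹ : ℝ) : ℂ))]
    exact hf.mul fun _ r _ _ => ((Delta M a k r ^ (-σ) * (Real.sqrt (r ^ 2 + a ^ 2))⁻¹ : ℝ) : ℂ)
  have hψ : ((Delta M a k r₀ ^ (-σ) * (Real.sqrt (r₀ ^ 2 + a ^ 2))⁻¹ : ℝ) : ℂ) * R r₀ ≠ 0 := by
    refine mul_ne_zero ?_ hR₀
    have h1 := h.Delta_pos hr₀
    have h2 : 0 < r₀ := h.rPlus_pos.trans hr₀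
    have h3 : 0 < Real.sqrt (r₀ ^ 2 + a ^ 2) := Real.sqrt_pos.2 (by positivity)
    exact_mod_cast (mul_pos (zpow_pos h1 (-σ)) (inv_pos.2 h3)).ne'
  obtain ⟨lam, hrad, hang⟩ := exists_separation h hσ hunf hT ⟨hr₀, h0, hpi⟩ hψ hS
  have hm' : max q₀ (max N₁ N₂) ≤ |(m : ℝ)| := by
    refine hm₀.trans ?_
    exact_mod_cast hm
  have hlam : angFloor M a k * |(m : ℝ)| ^ 2 - C * |(m : ℝ)| ≤ lam.re := by
    rw [sq_abs]
    exact le_re_of_angularOp h hSc b1 b2 b3 b4 hang h0 hpi hS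
      (hC m ((le_max_left _ _).trans hm'))
  have hq₁ := hN₁ _ (((le_max_left _ _).trans (le_max_right _ _)).trans hm')
  have hq₂ := hN₂ _ (((le_max_right _ _).trans (le_max_right _ _)).trans hm')
  have hode := fun r hr => hasDerivAt_tortoiseDeriv h hσ hRc hrad (r := r) hr
  have hflux : Tendsto (fun r => ((Delta M a k r / (r ^ 2 + a ^ 2) : ℝ) : ℂ) * deriv R r
      * (starRingEnd ℂ) (R r)) (𝓝[>] rPlus M a k) (𝓝 0) := by
    have hb := hhor.isBigO hf h0 hpi hS
    rcases hσ with rfl | rfl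
    · simp only [one_mul, zpow_one] at hb
      exact tendsto_flux_of_spin_pos h hRc hode hb (hC₃ m lam (by linarith))
    · exact tendsto_flux_of_spin_neg h hRc hb
  refine (IsRadialProfile.mul_const ⟨⟨radialPot M a k m lam, fun r hr => ⟨?_, ?_, hode r hr⟩⟩,
    hflux, hRlim, hRlim'⟩ (S θ) :)
  · have h1 := corot_term_le h hHR hr m
    have h2 := hC₂ r hr
    rw [radialPot_re]
    rw [sq_abs] at hq₂ hlam
    linarith
  · have hD := (h.Delta_pos hr).ne'
    have hP : r ^ 2 + a ^ 2 ≠ 0 := by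
      have := h.rPlus_pos.trans hr
      positivity
    rw [← mul_assoc, ← Complex.ofReal_mul, show (r ^ 2 + a ^ 2) / Delta M a k r
      * (Delta M a k r / (r ^ 2 + a ^ 2)) = 1 by field_simp, Complex.ofReal_one, one_mul]
    exact ((hRc.differentiableOn (by simp)).differentiableAt (isOpen_Ioi.mem_nhds hr)).hasDerivAt

end KerrAdS

theorem theorem1p2 (M a k : ℝ) (hadm : KerrAdS.Admissible M a k)
    (hHR : KerrAdS.HawkingReall M a k) :
    ∃ m₀ : ℕ, ∀ m : ℤ, (m₀ : ℤ) ≤ |m| →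
      ¬ ∃ fp fm : KerrAdS.Field,
        KerrAdS.IsStationaryMode M a k m fp fm ∧
        KerrAdS.Nontrivial M a k fp fm ∧
        KerrAdS.RegularUpToInfinity M a k 2 fp ∧
        KerrAdS.RegularUpToInfinity M a k (-2) fm ∧
        KerrAdS.SolvesTeukolsky M a k 1 fp ∧
        KerrAdS.SolvesTeukolsky M a k (-1) fm ∧
        KerrAdS.RegularAtHorizon M a k 1 fp ∧
        KerrAdS.RegularAtHorizon M a k (-1) fm ∧
        KerrAdS.ConformalBC M a k fp fm := by
  open KerrAdS in
  obtain ⟨m₀, H⟩ := exists_isRadialProfile hadm hHR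
  refine ⟨m₀, fun m hm => ?_⟩
  rintro ⟨fp, fm, ⟨Rp, Rm, Sp, Sm, hmode⟩, ⟨t₀, r₀, θ, φ₀, hx, hne⟩, rp, rm, tp, tm, hp, hn, hbc⟩
  have ep : ExtEq M a k fp (modeField M a k (1 * m) Rp Sp) := fun t r θ φ he => by
    rw [(hmode t r θ φ he).1, one_mul]; rfl
  have em : ExtEq M a k fm (modeField M a k (-1 * m) Rm Sm) := fun t r θ φ he => by
    rw [(hmode t r θ φ he).2]
    simp [modeField]
  have P := H 1 2 m Rp Sp fp (Or.inl rfl) hm ep rp tp hp θ hx.2.1 hx.2.2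
  have Q := H (-1) (-2) m Rm Sm fm (Or.inr rfl) hm em rm tm hn θ hx.2.1 hx.2.2
  have vp : ∀ r, rPlus M a k < r → fp 0 r θ 0 = Rp r * Sp θ := fun r hr => by
    rw [ep 0 r θ 0 ⟨hr, hx.2⟩]; simp [modeField]
  have vm : ∀ r, rPlus M a k < r → fm 0 r θ 0 = Rm r * Sm θ := fun r hr => by
    rw [em 0 r θ 0 ⟨hr, hx.2⟩]; simp [modeField]
  have dp : ∀ r, rPlus M a k < r → dR fp 0 r θ 0 = deriv Rp r * Sp θ := fun r hr => by
    rw [ep.dR 0 r θ 0 ⟨hr, hx.2⟩, dR_modeField]; simp [modeField]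
  have dm : ∀ r, rPlus M a k < r → dR fm 0 r θ 0 = deriv Rm r * Sm θ := fun r hr => by
    rw [em.dR 0 r θ 0 ⟨hr, hx.2⟩, dR_modeField]; simp [modeField]
  obtain ⟨c1, c2⟩ := hbc 0 θ 0 hx.2.1 hx.2.2
  have hzero := P.eq_zero hadm Q
    (c1.congr' (by
      filter_upwards [Ioi_mem_atTop (rPlus M a k)] with r hr
      rw [vp r hr, vm r hr]))
    (c2.congr' (by
      filter_upwards [Ioi_mem_atTop (rPlus M a k)] with r hr
      have hconj : dR (fun t r θ φ => (starRingEnd ℂ) (fm t r θ φ)) 0 r θ 0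
          = (starRingEnd ℂ) (dR fm 0 r θ 0) := by
        unfold dR
        exact deriv.star
      unfold dRStar
      rw [hconj, dp r hr, dm r hr]
      simp only [map_mul, Complex.conj_ofReal]
      ring)) r₀ hx.1
  rcases hne with hne | hne
  · refine hne ?_
    rw [(hmode t₀ r₀ θ φ₀ hx).1, mul_assoc (Complex.exp _), hzero.1]
    simp
  · refine hne ?_
    rw [(hmode t₀ r₀ θ φ₀ hx).2, mul_assoc (Complex.exp _), hzero.2]
    simp
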